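/- Let $n\ge 0$ be an integer. Let $\mathcal T_n$ be the set of trees on the vertex set $\{0,1,\dots,n\}$, rooted at $0$. The *total depth* $\mathrm{depth}(T)$ of $T\in\mathcal T_n$ is the sum of the distances from the root to all other vertices. For distinct vertices $i,j$, the vertex $j$ is a *descendant* of $i$ if $i$ lies on the path from $j$ to the root; $\mathrm{inv}(T)$ (respectively $\mathrm{coinv}(T)$) is the number of pairs $(i,j)$ such that $j$ is a descendant of $i$ and $i>j$ (respectively $i<j$). Put $$D_n(q):=\sum_{T\in\mathcal T_n}q^{\mathrm{inv}(T)+\mathrm{coinv}(T)}.$$ Let $\mathcal F_n$ be the set of sequences of $n$ transpositions $f=(a_1\,b_1)\cdots(a_n\,b_n)$ of $\{0,1,\dots,n\}$, written with $a_i<b_i$, whose product, multiplied from left to right, is the full cycle $(0\,1\,\cdots\,n)$. The *total difference* of $f$ is $\mathrm{diff}(f):=\sum_{i=1}^n(b_i-a_i)$. Let $\mathcal P_n$ be the set of parking functions of length $n$, that is, sequences $p\in\mathbb N^n$ of nonnegative integers whose non-decreasing rearrangement $(a_1',\dots,a_n')$ satisfies $a_i'\le i-1$ for all $i$. Such a $p$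 determines the lattice path $P$ from $(0,0)$ to $(n,n)$ with unit east and north steps whose $j$-th east step is at height $a_j'$. A ball starts at $(0,0)$. Whenever it is at a point $(i,i)$ with $i<n$, it moves east until it is blocked by a north step of $P$ that starts at height $i$, at abscissa $x$ say, and then moves north to $(x,x)$; it stops at $(n,n)$. If $0=i_1<\dots<i_m=n$ are the abscissas at which the ball meets the line $y=x$, then $\mathrm{bounce}(p):=\sum_{j=1}^m(n-i_j)$. **Theorem.** For every $k\in\mathbb N$ the following are equinumerous: (1) trees $T\in\mathcal T_n$ with total depth $k$; (2) factorizations $f\in\mathcal F_n$ with total difference $k$; (3) parking functions $p\in\mathcal P_n$ with bounce $k$. That is, $$D_n(q)=\sum_{T\in\mathcal T_n}q^{\mathrm{depth}(T)}=\sum_{f\in\mathcal F_n}q^{\mathrm{diff}(f)}=\sum_{p\in\mathcal P_n}q^{\mathrm{bounce}(p)}.$$ -/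

import Mathlib

open Polynomial

noncomputable section

namespace DepthBounce

/-! ### Labelled trees on the vertices `0, 1, …, n`, rooted at `0` -/

open Classical in
/-- The set of all trees on the vertex set `{0, 1, …, n}`. -/
def labelledTrees (n : ℕ) : Finset (SimpleGraph (Fin (n + 1))) :=
  Finset.univ.filter fun T => T.IsTree

/-- `j` is a descendant of `i`: the vertices are distinct and `i` lies on the path from `j`
to the root `0` (in a tree, this path exists and is unique). -/
def IsDescendant {n : ℕ} (T : SimpleGraph (Fin (n + 1))) (i j : Fin (n + 1)) : Prop :=
  i ≠ j ∧ ∃ w : T.Walk j 0, w.IsPath ∧ i ∈ w.support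

open Classical in
/-- The number of inversions: pairs `(i, j)` with `j` a descendant of `i` and `i > j`. -/
def inv {n : ℕ} (T : SimpleGraph (Fin (n + 1))) : ℕ :=
  (Finset.univ.filter fun ij : Fin (n + 1) × Fin (n + 1) =>
    IsDescendant T ij.1 ij.2 ∧ ij.2 < ij.1).card

open Classical in
/-- The number of coinversions: pairs `(i, j)` with `j` a descendant of `i` and `i < j`. -/
def coinv {n : ℕ} (T : SimpleGraph (Fin (n + 1))) : ℕ :=
  (Finset.univ.filter fun ij : Fin (n + 1) × Fin (n + 1) =>
    IsDescendant T ij.1 ij.2 ∧ ij.1 < ij.2).card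

/-- The total depth: the sum of the distances from the root to all vertices. -/
def totalDepth {n : ℕ} (T : SimpleGraph (Fin (n + 1))) : ℕ :=
  ∑ v, T.dist 0 v

/-- The polynomial `D_n(q) = ∑_T q ^ (inv T + coinv T)`. -/
def D (n : ℕ) : ℤ[X] :=
  ∑ T ∈ labelledTrees n, X ^ (inv T + coinv T)

/-! ### Minimal factorizations of the full cycle `(0 1 ⋯ n)` -/

/-- The product `t₁ t₂ ⋯ tₙ`, multiplied from left to right: `t₁` is applied first. (Mathlib
multiplies permutations from right to left, so the list of factors is reversed.) -/
def leftToRightProd {n : ℕ} (t : Fin n → Equiv.Perm (Fin (n + 1))) :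
    Equiv.Perm (Fin (n + 1)) :=
  (List.ofFn t).reverse.prod

open Classical in
/-- Sequences of `n` transpositions whose left-to-right product is the full cycle
`(0 1 ⋯ n)`, which is `finRotate (n + 1)`. -/
def minimalFactorizations (n : ℕ) : Finset (Fin n → Equiv.Perm (Fin (n + 1))) :=
  Finset.univ.filter fun t =>
    (∀ i, (t i).IsSwap) ∧ leftToRightProd t = finRotate (n + 1)

/-- The least element `a` moved by a transposition `(a b)`, where `a < b`. -/
def lower {n : ℕ} (τ : Equiv.Perm (Fin (n + 1))) : Fin (n + 1) := τ.support.inf id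

/-- The greatest element `b` moved by a transposition `(a b)`, where `a < b`. -/
def upper {n : ℕ} (τ : Equiv.Perm (Fin (n + 1))) : Fin (n + 1) := τ.support.sup id

theorem lower_swap {n : ℕ} {a b : Fin (n + 1)} (h : a < b) : lower (Equiv.swap a b) = a := by
  simp [lower, Equiv.Perm.support_swap h.ne, h.le]

theorem upper_swap {n : ℕ} {a b : Fin (n + 1)} (h : a < b) : upper (Equiv.swap a b) = b := by
  simp [upper, Equiv.Perm.support_swap h.ne, h.le]

/-- The total difference `∑ᵢ (bᵢ - aᵢ)` of `(a₁ b₁) ⋯ (aₙ bₙ)`, where `aᵢ < bᵢ`. -/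
def totalDifference {n : ℕ} (t : Fin n → Equiv.Perm (Fin (n + 1))) : ℕ :=
  ∑ i, ((upper (t i) : ℕ) - (lower (t i) : ℕ))

/-! ### Parking functions and the bounce statistic -/

/-- The non-decreasing rearrangement of a sequence. -/
def rearrangement {n : ℕ} (a : Fin n → ℕ) : Fin n → ℕ := a ∘ Tuple.sort a

/-- The non-decreasing rearrangement `(a'₁, …, a'ₙ)` satisfies `a'ᵢ ≤ i - 1` for all `i`
(indices are counted from `0` here). -/
def IsParkingFunction {n : ℕ} (a : Fin n → ℕ) : Prop :=
  ∀ i : Fin n, rearrangement a i ≤ i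

open Classical in
/-- The finite set of parking functions of length `n`; all their entries are less than `n`. -/
def parkingFunctions (n : ℕ) : Finset (Fin n → ℕ) :=
  (Fintype.piFinset fun _ => Finset.range n).filter IsParkingFunction

theorem mem_parkingFunctions {n : ℕ} {a : Fin n → ℕ} :
    a ∈ parkingFunctions n ↔ IsParkingFunction a := by
  simp only [parkingFunctions, Finset.mem_filter, Fintype.mem_piFinset, Finset.mem_range,
    and_iff_right_iff_imp]
  intro h i
  have h1 := h ((Tuple.sort a).symm i)
  simp only [rearrangement, Function.comp_apply, Equiv.apply_symm_apply] at h1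
  exact h1.trans_lt (Fin.is_lt _)

/-- The lattice path of `a` from `(0, 0)` to `(n, n)` has, for each `x < n`, one horizontal step
from abscissa `x` to `x + 1`, at the height `rearrangement a x`. After the last horizontal
step the path rises to the height `n`. -/
def stepHeight {n : ℕ} (a : Fin n → ℕ) (x : ℕ) : ℕ :=
  if h : x < n then rearrangement a ⟨x, h⟩ else n

/-- The lattice path of `a` contains the vertical step from `(x, y)` to `(x, y + 1)`: at the
abscissa `x` it arrives at height at most `y` and leaves at height at least `y + 1`. -/
def HasVerticalStep {n : ℕ} (a : Fin n → ℕ) (x y : ℕ) : Prop :=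
  x ≤ n ∧ (0 < x → stepHeight a (x - 1) ≤ y) ∧ y + 1 ≤ stepHeight a x

/-- The bouncing ball meets the diagonal at `(x, x)`. It starts at `(0, 0)`. From a point
`(i, i)` of the diagonal with `i < n` it moves east, at height `i`, until it is blocked by a
vertical step of the path (one that goes up from height `i`), at abscissa `x` say; then it moves
north from `(x, i)` to the point `(x, x)` of the diagonal. It stops at `(n, n)`. -/
inductive MeetsDiagonal {n : ℕ} (a : Fin n → ℕ) : ℕ → Prop
  | start : MeetsDiagonal a 0
  | bounce {i x : ℕ} (hi : MeetsDiagonal a i) (hin : i < n)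
      (hx : IsLeast {x | i ≤ x ∧ HasVerticalStep a x i} x) : MeetsDiagonal a x

open Classical in
/-- The bounce of `a`: the sum of `n - i` over the points `(i, i)`, `0 ≤ i ≤ n`, at which the ball
meets the diagonal. -/
def bounce {n : ℕ} (a : Fin n → ℕ) : ℕ :=
  ∑ i ∈ (Finset.range (n + 1)).filter (MeetsDiagonal a), (n - i)

end DepthBounce

end

open DepthBounce

/-!
The height of a point `p` under a factorization is the number of its transpositions `(a b)` with
`a < p ≤ b`, so the total difference is the sum of the heights. If the first transposition of a
factorization is `(a b)`, the others form a shuffle of a factorization of the cycle on `(a, b]` and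
a factorization of the cycle on the complement: each transposition joins at most two connected
components, so there are too few of them to connect these two sets as well. For a tree, cutting the
edge above a vertex `x` leaves the subtree at `x` and a tree with a marked vertex. Hence the
multisets of heights and the multisets of depths satisfy the same recursion.

A depth function `d` with `N k` vertices of depth `k` belongs to `∏ j ≠ 0, N (d j - 1)` trees. This
is also the number of parking functions `a` for which the ball needs `d j - 1` bounces to get
to an abscissa of at least `a j`, and their bounce is the sum of the depths.

A vertex has as many proper ancestors as its distance from the root, so `inv + coinv` is the total
depth.
-/

noncomputable section

namespace DepthBounce

/-! ### Products of transpositions -/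

section Swaps

variable {ι α β γ : Type*} [DecidableEq α] [DecidableEq β]

/-- The product of the transpositions given by a list of pairs; the first one is applied first. -/
def swapProd (s : List (α × α)) : Equiv.Perm α :=
  (s.map fun e => Equiv.swap e.1 e.2).reverse.prod

theorem swapProd_cons (e : α × α) (s : List (α × α)) :
    swapProd (e :: s) = swapProd s * Equiv.swap e.1 e.2 := by
  simp [swapProd]

theorem swapProd_cons_apply (e : α × α) (s : List (α × α)) (x : α) :
    swapProd (e :: s) x = swapProd s (Equiv.swap e.1 e.2 x) := by
  rw [swapProd_cons, Equiv.Perm.mul_apply]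

theorem color_swapProd {c : α → γ} :
    ∀ {s : List (α × α)}, (∀ e ∈ s, c e.1 = c e.2) → ∀ x, c (swapProd s x) = c x
  | [], _, _ => rfl
  | e :: s, h, x => by
    have he : c e.1 = c e.2 := h e List.mem_cons_self
    rw [swapProd_cons_apply, color_swapProd fun d hd => h d (List.mem_cons_of_mem e hd)]
    grind

theorem exists_coloring (V : Finset α) :
    ∀ s : List (α × α), ∃ c : α → α, (∀ e ∈ s, c e.1 = c e.2) ∧
      V.card ≤ (V.image c).card + s.length
  | [] => ⟨id, by simp, by simp⟩
  | e :: s => by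
    obtain ⟨c, hc, hV⟩ := exists_coloring V s
    let c' x := if c x = c e.1 then c e.2 else c x
    have hc' : ∀ d ∈ e :: s, c' d.1 = c' d.2 := by grind
    have himage : V.image c ⊆ insert (c e.1) (V.image c') := by grind
    have hcard := (Finset.card_le_card himage).trans (Finset.card_insert_le _ _)
    exact ⟨c', hc', by rw [List.length_cons]; omega⟩

theorem swapProd_map_shuffle (P : ι → Prop) [DecidablePred P] {f : ι → β × β} {g : ι → α × α}
    {e : α → β} (he : e.Injective) {D : Set α} :
    ∀ {l : List ι}, (∀ i ∈ l, P i → f i = (g i).map e e ∧ (g i).1 ∈ D ∧ (g i).2 ∈ D) →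
      (∀ i ∈ l, ¬ P i → ∀ y ∈ D, e y ≠ (f i).1 ∧ e y ≠ (f i).2) →
      ∀ {y}, y ∈ D → swapProd (l.map f) (e y) = e (swapProd ((l.filter P).map g) y)
  | [], _, _, _, _ => rfl
  | i :: l, hin, hout, y, hy => by
    have ih {z} (hz : z ∈ D) := swapProd_map_shuffle P he (fun j hj => hin j (.tail i hj))
      (fun j hj => hout j (.tail i hj)) hz
    by_cases hi : P i
    · obtain ⟨hfi, hg₁, hg₂⟩ := hin i List.mem_cons_self hi
      have hD : Equiv.swap (g i).1 (g i).2 y ∈ D := by grind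
      rw [List.filter_cons_of_pos (by simpa using hi), List.map_cons, List.map_cons,
        swapProd_cons_apply, swapProd_cons_apply, ← ih hD, ← he.swap_apply, hfi]
      rfl
    · obtain ⟨h₁, h₂⟩ := hout i List.mem_cons_self hi y hy
      rw [List.filter_cons_of_neg (by simpa using hi), List.map_cons, swapProd_cons_apply,
        Equiv.swap_apply_of_ne_of_ne h₁ h₂, ih hy]

theorem swapProd_map {e : α → β} (he : e.Injective) (l : List (α × α)) (y : α) :
    swapProd (l.map (Prod.map e e)) (e y) = e (swapProd l y) := by
  simpa using swapProd_map_shuffle (fun _ => True) (g := id) he (D := Set.univ) (l := l)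
    (by simp) (by simp) (Set.mem_univ y)

end Swaps

section Cycles

/-- The cycle `(0 1 ⋯ n)` as a map on the natural numbers. -/
def cycleMap (n x : ℕ) : ℕ := if x < n then x + 1 else if x = n then 0 else x

theorem color_eq_of_cycleMap {γ : Type*} {c : ℕ → γ} {n : ℕ}
    (h : ∀ x ≤ n, c (cycleMap n x) = c x) : ∀ x ≤ n, c x = c 0
  | 0, _ => rfl
  | x + 1, hx => by
    have hc := h x (by omega)
    rw [cycleMap, if_pos (by omega)] at hc
    rw [hc, color_eq_of_cycleMap h x (by omega)]

/-- A colouring constant on the transpositions is constant on `0, …, n`, and each of the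
transpositions reduces the number of colours by at most one. -/
theorem le_length_of_swapProd_eq_cycleMap {s : List (ℕ × ℕ)} {n : ℕ}
    (h : ∀ x ≤ n, swapProd s x = cycleMap n x) : n ≤ s.length := by
  obtain ⟨c, hc, hcard⟩ := exists_coloring (Finset.range (n + 1)) s
  have hconst := color_eq_of_cycleMap (c := c) fun x hx => by rw [← h x hx, color_swapProd hc]
  have himage : (Finset.range (n + 1)).image c ⊆ {c 0} := by
    simpa [Finset.subset_iff, Nat.lt_succ_iff] using hconst
  have := Finset.card_le_card himage
  rw [Finset.card_singleton] at this
  rw [Finset.card_range] at hcard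
  omega

/-- The increasing map that leaves out the interval `(a, a + w]`. -/
def skip (a w y : ℕ) : ℕ := if y ≤ a then y else y + w

/-- The left inverse of `skip a w`. -/
def unskip (a w y : ℕ) : ℕ := if y ≤ a then y else y - w

theorem skip_strictMono (a w : ℕ) : StrictMono (skip a w) := by
  grind [StrictMono, skip]

theorem unskip_skip (a w y : ℕ) : unskip a w (skip a w y) = y := by
  grind [skip, unskip]

theorem skip_unskip {a w y : ℕ} (h : ¬ (a < y ∧ y ≤ a + w)) : skip a w (unskip a w y) = y := by
  grind [skip, unskip]

theorem skip_notMem (a w y : ℕ) : ¬ (a < skip a w y ∧ skip a w y ≤ a + w) := by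
  grind [skip]

theorem forall_le_iff_add_skip {p : ℕ → Prop} {a k : ℕ} (m : ℕ) (ha : a ≤ k) :
    (∀ x ≤ m + k + 1, p x) ↔
      (∀ y ≤ m, p (y + (a + 1))) ∧ ∀ y ≤ k, p (skip a (m + 1) y) := by
  refine ⟨fun h => ⟨fun y hy => h _ (by omega), fun y hy => h _ (by grind [skip])⟩,
    fun ⟨hin, hout⟩ x hx => ?_⟩
  by_cases hx' : a < x ∧ x ≤ a + (m + 1)
  · simpa [show x - (a + 1) + (a + 1) = x by omega] using hin (x - (a + 1)) (by omega)
  · simpa [skip_unskip hx'] using hout (unskip a (m + 1) x) (by grind [unskip])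

theorem cycleMap_swap_add {a k m y : ℕ} (ha : a ≤ k) (hy : y ≤ m) :
    cycleMap (m + k + 1) (Equiv.swap a (a + (m + 1)) (y + (a + 1))) =
      cycleMap m y + (a + 1) := by
  grind [cycleMap]

theorem cycleMap_swap_skip {a k y : ℕ} (m : ℕ) (ha : a ≤ k) (hy : y ≤ k) :
    cycleMap (m + k + 1) (Equiv.swap a (a + (m + 1)) (skip a (m + 1) y)) =
      skip a (m + 1) (cycleMap k y) := by
  grind [cycleMap, skip]

theorem apply_swap_eq_cycleMap_iff {σ : ℕ → ℕ} {a k : ℕ} (m : ℕ) (ha : a ≤ k) :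
    (∀ x ≤ m + k + 1, σ (Equiv.swap a (a + (m + 1)) x) = cycleMap (m + k + 1) x) ↔
      (∀ y ≤ m, σ (y + (a + 1)) = cycleMap m y + (a + 1)) ∧
        ∀ y ≤ k, σ (skip a (m + 1) y) = skip a (m + 1) (cycleMap k y) := by
  have hle {x} (hx : x ≤ m + k + 1) : Equiv.swap a (a + (m + 1)) x ≤ m + k + 1 := by
    grind
  calc
    _ ↔ ∀ x ≤ m + k + 1, σ x = cycleMap (m + k + 1) (Equiv.swap a (a + (m + 1)) x) :=
      ⟨fun h x hx => by rw [← h _ (hle hx), Equiv.swap_apply_self],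
        fun h x hx => by rw [h _ (hle hx), Equiv.swap_apply_self]⟩
    _ ↔ _ := by
      rw [forall_le_iff_add_skip m ha]
      exact and_congr (forall₂_congr fun y hy => by rw [cycleMap_swap_add ha hy])
        (forall₂_congr fun y hy => by rw [cycleMap_swap_skip m ha hy])

end Cycles

/-! ### Factorizations of a cycle and their height profiles -/

section Factorizations

variable {ι : Type*}

/-- The pairs `f i`, taken in the order of the list `l` of labels, form a factorization of the
cycle `(0 1 ⋯ n)` into transpositions `(a b)`, where `a < b`. -/
def IsFactorization (n : ℕ) (l : List ι) (f : ι → ℕ × ℕ) : Prop :=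
  (∀ i ∈ l, (f i).1 < (f i).2 ∧ (f i).2 ≤ n) ∧ ∀ x ≤ n, swapProd (l.map f) x = cycleMap n x

theorem IsFactorization.le_length {n : ℕ} {l : List ι} {f : ι → ℕ × ℕ}
    (h : IsFactorization n l f) : n ≤ l.length := by
  simpa using le_length_of_swapProd_eq_cycleMap h.2

/-- The number of pairs `(a, b)` with `a < p ≤ b`. Viewing `(a, b)` as an arc over the half-open
interval `(a, b]`, this is the number of arcs over `p`. -/
def height (l : List ι) (f : ι → ℕ × ℕ) (p : ℕ) : ℕ :=
  l.countP fun i => (f i).1 < p ∧ p ≤ (f i).2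

theorem height_cons (x : ι) (l : List ι) (f : ι → ℕ × ℕ) (p : ℕ) : height (x :: l) f p =
    height l f p + if (f x).1 < p ∧ p ≤ (f x).2 then 1 else 0 := by
  simp [height, List.countP_cons]

theorem height_filter_add [DecidableEq ι] (l : List ι) (S : Finset ι) (f : ι → ℕ × ℕ) (p : ℕ) :
    height l f p = height (l.filter (· ∈ S)) f p + height (l.filter (· ∉ S)) f p := by
  simpa [height] using List.countP_eq_countP_filter_add l _ (· ∈ S)

/-- The multiset of the heights of the points `0, …, l.length`. -/
def profile (l : List ι) (f : ι → ℕ × ℕ) : Multiset ℕ :=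
  (Multiset.range (l.length + 1)).map (height l f)

theorem height_zero (l : List ι) (f : ι → ℕ × ℕ) : height l f 0 = 0 := by
  simp [height]

theorem IsFactorization.height_eq_zero {n p : ℕ} {l : List ι} {f : ι → ℕ × ℕ}
    (h : IsFactorization n l f) (hp : n < p) : height l f p = 0 := by
  rw [height, List.countP_eq_zero]
  intro i hi
  have := (h.1 i hi).2
  simp only [decide_eq_true_eq]
  omega

theorem map_range_add_one_eq_map_succ {α : Type*} {n : ℕ} {F : ℕ → α} (h : F 0 = F (n + 1)) :
    (Multiset.range (n + 1)).map F = (Multiset.range (n + 1)).map fun p => F (p + 1) := by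
  have hsucc : (Multiset.range (n + 1)).map F =
      F 0 ::ₘ (Multiset.range n).map fun p => F (p + 1) := by
    simp_rw [← Multiset.coe_range, List.range_succ_eq_map, Multiset.map_coe, List.map_cons,
      List.map_map, Multiset.cons_coe, Function.comp_def]
  rw [hsucc, Multiset.range_succ, Multiset.map_cons, h]

theorem IsFactorization.profile_eq {l : List ι} {f : ι → ℕ × ℕ}
    (h : IsFactorization l.length l f) :
    profile l f = (Multiset.range (l.length + 1)).map fun a => height l f (a + 1) :=
  map_range_add_one_eq_map_succ <| by
    rw [height_zero, h.height_eq_zero (Nat.lt_succ_self _)]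

theorem sum_profile {l : List ι} {f : ι → ℕ × ℕ} (h : ∀ i ∈ l, (f i).2 ≤ l.length) :
    (profile l f).sum = (l.map fun i => (f i).2 - (f i).1).sum := by
  have hcard (e : ℕ × ℕ) (he : e.2 ≤ l.length) :
      ((Finset.range (l.length + 1)).filter fun p => e.1 < p ∧ p ≤ e.2).card = e.2 - e.1 := by
    rw [← Nat.card_Ioc]
    congr 1
    grind
  have hsum (k : List ι) (hk : ∀ i ∈ k, (f i).2 ≤ l.length) :
      ∑ p ∈ Finset.range (l.length + 1), height k f p =
        (k.map fun i => (f i).2 - (f i).1).sum := by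
    induction k with
    | nil => simp [height]
    | cons i k ih =>
      rw [List.map_cons, List.sum_cons, ← ih (by grind), ← hcard (f i) (hk i (by simp)),
        Finset.card_filter, ← Finset.sum_add_distrib]
      refine Finset.sum_congr rfl fun p _ => ?_
      simp [height, List.countP_cons, add_comm]
  exact hsum l h

/-- The transpositions after `(a b)` are too few to connect `(a, b]` with its complement. -/
theorem IsFactorization.exists_separating_coloring {x : ι} {l : List ι} {f : ι → ℕ × ℕ}
    {a k m : ℕ} (hf : IsFactorization (m + k + 1) (x :: l) f) (hl : l.length = m + k)
    (ha : a ≤ k) (hx : f x = (a, a + (m + 1))) :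
    ∃ c : ℕ → ℕ, (∀ i ∈ l, c (f i).1 = c (f i).2) ∧
      ∀ y ≤ m + k + 1, y ∈ Finset.Ioc a (a + (m + 1)) ↔ c y = c (0 + (a + 1)) := by
  have hprod := hf.2
  simp only [List.map_cons, swapProd_cons_apply, hx] at hprod
  rw [apply_swap_eq_cycleMap_iff m ha] at hprod
  obtain ⟨c, hc, hcard⟩ := exists_coloring (Finset.range (m + k + 1 + 1)) (l.map f)
  have hin : ∀ y ≤ m, c (y + (a + 1)) = c (0 + (a + 1)) :=
    color_eq_of_cycleMap (c := fun y => c (y + (a + 1))) fun y hy => by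
      rw [← hprod.1 y hy, color_swapProd hc]
  have hout : ∀ y ≤ k, c (skip a (m + 1) y) = c (skip a (m + 1) 0) :=
    color_eq_of_cycleMap (c := fun y => c (skip a (m + 1) y)) fun y hy => by
      rw [← hprod.2 y hy, color_swapProd hc]
  have hne : c (0 + (a + 1)) ≠ c (skip a (m + 1) 0) := by
    intro heq
    have hconst : ∀ y ≤ m + k + 1, c y = c (skip a (m + 1) 0) :=
      (forall_le_iff_add_skip m ha).2 ⟨fun y hy => (hin y hy).trans heq, hout⟩
    have himage : (Finset.range (m + k + 1 + 1)).image c ⊆ {c (skip a (m + 1) 0)} := by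
      simpa [Finset.subset_iff, Nat.lt_succ_iff] using hconst
    have := Finset.card_le_card himage
    rw [Finset.card_singleton] at this
    rw [Finset.card_range, List.length_map] at hcard
    omega
  refine ⟨c, fun i hi => hc (f i) (List.mem_map_of_mem hi),
    (forall_le_iff_add_skip m ha).2 ⟨fun y hy => ?_, fun y hy => ?_⟩⟩
  · exact iff_of_true (by rw [Finset.mem_Ioc]; omega) (hin y hy)
  · rw [Finset.mem_Ioc]
    exact iff_of_false (skip_notMem _ _ _) (by rw [hout y hy]; exact hne.symm)

theorem IsFactorization.mem_Ioc_iff {x : ι} {l : List ι} {f : ι → ℕ × ℕ} {a k m : ℕ}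
    (hf : IsFactorization (m + k + 1) (x :: l) f)
    (hl : l.length = m + k) (ha : a ≤ k) (hx : f x = (a, a + (m + 1))) {i : ι} (hi : i ∈ l) :
    (f i).1 ∈ Finset.Ioc a (a + (m + 1)) ↔ (f i).2 ∈ Finset.Ioc a (a + (m + 1)) := by
  obtain ⟨c, hc, hmem⟩ := hf.exists_separating_coloring hl ha hx
  have hle := hf.1 i (List.mem_cons_of_mem x hi)
  rw [hmem _ (hle.1.le.trans hle.2), hmem _ hle.2, hc i hi]

end Factorizations

section Gluing

variable {ι : Type*} {x : ι} {l : List ι} {S : Finset ι} {a k m : ℕ} {f g h : ι → ℕ × ℕ}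

/-- The family `f` on `x :: l` consists of the pair `(a, a + m + 1)` at `x` and of a shuffle of
two families: `h`, on the labels in `S`, moved to the interval `(a, a + m + 1]`, and `g`, on the
other labels, moved to the complement of this interval. -/
structure IsGluing (x : ι) (l : List ι) (S : Finset ι) (a m : ℕ) (f g h : ι → ℕ × ℕ) : Prop where
  first : f x = (a, a + (m + 1))
  inner : ∀ i ∈ l, i ∈ S → f i = (h i).map (· + (a + 1)) (· + (a + 1))
  inner_le : ∀ i ∈ l, i ∈ S → (h i).1 ≤ m ∧ (h i).2 ≤ m
  outer : ∀ i ∈ l, i ∉ S → f i = (g i).map (skip a (m + 1)) (skip a (m + 1))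

namespace IsGluing

theorem mem_iff (H : IsGluing x l S a m f g h) {i : ι} (hi : i ∈ l) :
    i ∈ S ↔ (f x).1 < (f i).1 ∧ (f i).1 ≤ (f x).2 := by
  by_cases hS : i ∈ S
  · have := H.inner_le i hi hS
    simp only [hS, H.first, H.inner i hi hS, Prod.map_fst, true_iff]
    omega
  · simp [hS, H.first, H.outer i hi hS, skip_notMem]

variable [DecidableEq ι]

theorem swapProd_add (H : IsGluing x l S a m f g h) {y : ℕ} (hy : y ≤ m) :
    swapProd (l.map f) (y + (a + 1)) =
      swapProd ((l.filter (· ∈ S)).map h) y + (a + 1) := by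
  refine swapProd_map_shuffle (· ∈ S) (e := (· + (a + 1))) (D := {y | y ≤ m})
    (add_left_injective _) (fun i hi hS => ⟨H.inner i hi hS, H.inner_le i hi hS⟩)
    (fun i hi hS y hy => ?_) hy
  have h₁ := skip_notMem a (m + 1) (g i).1
  have h₂ := skip_notMem a (m + 1) (g i).2
  simp only [H.outer i hi hS, Prod.map_fst, Prod.map_snd, Set.mem_ofPred_eq] at hy ⊢
  omega

theorem swapProd_skip (H : IsGluing x l S a m f g h) (y : ℕ) :
    swapProd (l.map f) (skip a (m + 1) y) =
      skip a (m + 1) (swapProd ((l.filter (· ∉ S)).map g) y) := by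
  refine swapProd_map_shuffle (· ∉ S) (D := Set.univ) (skip_strictMono _ _).injective
    (fun i hi hS => ⟨H.outer i hi hS, trivial, trivial⟩) (fun i hi hS y _ => ?_) trivial
  rw [not_not] at hS
  have hskip := skip_notMem a (m + 1) y
  have hle := H.inner_le i hi hS
  simp only [H.inner i hi hS, Prod.map_fst, Prod.map_snd]
  omega

theorem forall_lt_and_le_iff (H : IsGluing x l S a m f g h) (ha : a ≤ k) :
    (∀ i ∈ x :: l, (f i).1 < (f i).2 ∧ (f i).2 ≤ m + k + 1) ↔
      (∀ i ∈ l.filter (· ∈ S), (h i).1 < (h i).2 ∧ (h i).2 ≤ m) ∧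
        ∀ i ∈ l.filter (· ∉ S), (g i).1 < (g i).2 ∧ (g i).2 ≤ k := by
  have hin : ∀ i ∈ l, i ∈ S →
      ((f i).1 < (f i).2 ∧ (f i).2 ≤ m + k + 1 ↔ (h i).1 < (h i).2 ∧ (h i).2 ≤ m) := by
    intro i hi hS
    have := H.inner_le i hi hS
    simp only [H.inner i hi hS, Prod.map_fst, Prod.map_snd]
    omega
  have hout : ∀ i ∈ l, i ∉ S →
      ((f i).1 < (f i).2 ∧ (f i).2 ≤ m + k + 1 ↔ (g i).1 < (g i).2 ∧ (g i).2 ≤ k) := by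
    intro i hi hS
    simp only [H.outer i hi hS, Prod.map_fst, Prod.map_snd, (skip_strictMono _ _).lt_iff_lt]
    grind [skip]
  have hx : (f x).1 < (f x).2 ∧ (f x).2 ≤ m + k + 1 := by
    simp only [H.first]
    omega
  simp only [List.forall_mem_cons, List.mem_filter, decide_eq_true_eq, and_imp, hx.1, hx.2,
    and_self, true_and]
  refine ⟨fun hf => ⟨fun i hi hS => (hin i hi hS).1 (hf i hi),
    fun i hi hS => (hout i hi hS).1 (hf i hi)⟩, fun ⟨hh, hg⟩ i hi => ?_⟩
  by_cases hS : i ∈ S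
  exacts [(hin i hi hS).2 (hh i hi hS), (hout i hi hS).2 (hg i hi hS)]

theorem isFactorization_iff (H : IsGluing x l S a m f g h) (ha : a ≤ k) :
    IsFactorization (m + k + 1) (x :: l) f ↔
      IsFactorization m (l.filter (· ∈ S)) h ∧ IsFactorization k (l.filter (· ∉ S)) g := by
  have hprod : (∀ y ≤ m + k + 1, swapProd ((x :: l).map f) y = cycleMap (m + k + 1) y) ↔
      (∀ y ≤ m, swapProd ((l.filter (· ∈ S)).map h) y = cycleMap m y) ∧
        ∀ y ≤ k, swapProd ((l.filter (· ∉ S)).map g) y = cycleMap k y := by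
    simp only [List.map_cons, swapProd_cons_apply, H.first]
    rw [apply_swap_eq_cycleMap_iff m ha]
    refine and_congr (forall₂_congr fun y hy => ?_) (forall₂_congr fun y hy => ?_)
    · rw [H.swapProd_add hy, add_left_inj]
    · rw [H.swapProd_skip, (skip_strictMono _ _).injective.eq_iff]
  rw [IsFactorization, H.forall_lt_and_le_iff ha, hprod]
  exact and_and_and_comm

theorem height_add (H : IsGluing x l S a m f g h) {y : ℕ} (hy : y ≤ m) :
    height (x :: l) f (y + (a + 1)) =
      height (l.filter (· ∈ S)) h y + (height (l.filter (· ∉ S)) g (a + 1) + 1) := by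
  have hin : height (l.filter (· ∈ S)) f (y + (a + 1)) = height (l.filter (· ∈ S)) h y :=
    List.countP_congr fun i hi => by
      obtain ⟨hi, hS⟩ : i ∈ l ∧ i ∈ S := by simpa using hi
      simp [H.inner i hi hS]
  have hout : height (l.filter (· ∉ S)) f (y + (a + 1)) =
      height (l.filter (· ∉ S)) g (a + 1) :=
    List.countP_congr fun i hi => by
      obtain ⟨hi, hS⟩ : i ∈ l ∧ i ∉ S := by simpa using hi
      simp only [H.outer i hi hS, Prod.map_fst, Prod.map_snd, decide_eq_true_eq, skip]
      grind
  rw [height_cons, height_filter_add l S, hin, hout, H.first, if_pos (by dsimp only; omega),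
    add_assoc]

theorem height_skip (H : IsGluing x l S a m f g h) (y : ℕ) :
    height (x :: l) f (skip a (m + 1) y) = height (l.filter (· ∉ S)) g y := by
  have hskip := skip_notMem a (m + 1) y
  have hin : height (l.filter (· ∈ S)) f (skip a (m + 1) y) = 0 := by
    rw [height, List.countP_eq_zero]
    intro i hi
    obtain ⟨hi, hS⟩ : i ∈ l ∧ i ∈ S := by simpa using hi
    have := H.inner_le i hi hS
    simp only [H.inner i hi hS, Prod.map_fst, Prod.map_snd, decide_eq_true_eq]
    omega
  have hout : height (l.filter (· ∉ S)) f (skip a (m + 1) y) = height (l.filter (· ∉ S)) g y :=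
    List.countP_congr fun i hi => by
      obtain ⟨hi, hS⟩ : i ∈ l ∧ i ∉ S := by simpa using hi
      simp [H.outer i hi hS, (skip_strictMono a (m + 1)).lt_iff_lt,
        (skip_strictMono a (m + 1)).le_iff_le]
  rw [height_cons, height_filter_add l S, hin, hout, H.first, if_neg (by dsimp only; omega),
    zero_add, add_zero]

end IsGluing

end Gluing

section Gluing

variable {ι : Type*} [DecidableEq ι] {x : ι} {l : List ι} {S : Finset ι} {a k m : ℕ}
  {f g h : ι → ℕ × ℕ}

theorem length_filter_add (l : List ι) (S : Finset ι) :
    l.length = (l.filter (· ∈ S)).length + (l.filter (· ∉ S)).length := by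
  simpa using List.length_eq_length_filter_add (l := l) (· ∈ S)

theorem range_eq_add_map_skip (m : ℕ) (ha : a ≤ k) :
    Multiset.range (m + k + 1 + 1) = (Multiset.range (k + 1)).map (skip a (m + 1)) +
      (Multiset.range (m + 1)).map (· + (a + 1)) := by
  have hnodup : ((Multiset.range (k + 1)).map (skip a (m + 1)) +
      (Multiset.range (m + 1)).map (· + (a + 1))).Nodup := by
    refine Multiset.nodup_add.2 ⟨(Multiset.nodup_range _).map (skip_strictMono _ _).injective,
      (Multiset.nodup_range _).map (add_left_injective _), Multiset.disjoint_left.2 ?_⟩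
    simp only [Multiset.mem_map, Multiset.mem_range]
    rintro _ ⟨y, -, rfl⟩ ⟨z, hz, h⟩
    have := skip_notMem a (m + 1) y
    omega
  refine ((Multiset.nodup_range _).ext hnodup).2 fun y => ?_
  simp only [Multiset.mem_add, Multiset.mem_map, Multiset.mem_range]
  refine ⟨fun hy => ?_, ?_⟩
  · by_cases hya : a < y ∧ y ≤ a + (m + 1)
    · exact .inr ⟨y - (a + 1), by omega, by omega⟩
    · exact .inl ⟨unskip a (m + 1) y, by grind [unskip], skip_unskip hya⟩
  · grind [skip]

theorem IsGluing.profile_eq (H : IsGluing x l S a (l.filter (· ∈ S)).length f g h)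
    (ha : a ≤ (l.filter (· ∉ S)).length) :
    profile (x :: l) f = (Multiset.range ((l.filter (· ∉ S)).length + 1)).map
        (height (l.filter (· ∉ S)) g) +
      (profile (l.filter (· ∈ S)) h).map
        (· + (height (l.filter (· ∉ S)) g (a + 1) + 1)) := by
  rw [profile, profile, List.length_cons, length_filter_add l S, range_eq_add_map_skip _ ha,
    Multiset.map_add, Multiset.map_map, Multiset.map_map, Multiset.map_map]
  refine congrArg₂ _ (Multiset.map_congr rfl fun y _ => H.height_skip y)
    (Multiset.map_congr rfl fun y hy => H.height_add ?_)
  exact Nat.le_of_lt_succ (Multiset.mem_range.1 hy)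

theorem map_skip_zero (a w : ℕ) : Prod.map (skip a w) (skip a w) 0 = 0 := by
  simp [skip, Prod.ext_iff]

theorem map_unskip_zero (a w : ℕ) : Prod.map (unskip a w) (unskip a w) 0 = 0 := by
  simp [unskip, Prod.ext_iff]

/-- The labels of the pairs that start in the interval `(a, b]`, where `(a, b)` is the pair
at `x`. -/
def innerLabels (x : ι) (l : List ι) (f : ι → ℕ × ℕ) : Finset ι :=
  l.toFinset.filter fun i => (f x).1 < (f i).1 ∧ (f i).1 ≤ (f x).2

/-- The restriction of `f` to `S`, moved from the interval `(a, ∞)` to `[0, ∞)`. -/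
def innerPart (S : Finset ι) (a : ℕ) (f : ι → ℕ × ℕ) : ι → ℕ × ℕ :=
  S.piecewise (fun i => (f i).map (· - (a + 1)) (· - (a + 1))) 0

/-- The restriction of `f` to the complement of `S`, moved from the complement of the interval
`(a, a + w]` to `[0, ∞)`. -/
def outerPart (S : Finset ι) (a w : ℕ) (f : ι → ℕ × ℕ) : ι → ℕ × ℕ :=
  S.piecewise 0 fun i => (f i).map (unskip a w) (unskip a w)

/-- The family `f` with `IsGluing x l S a m f g h`, for labels `x ∉ l` and `S ⊆ l`. -/
def glue (x : ι) (S : Finset ι) (a m : ℕ) (g h : ι → ℕ × ℕ) : ι → ℕ × ℕ :=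
  Function.update (S.piecewise (fun i => (h i).map (· + (a + 1)) (· + (a + 1)))
    fun i => (g i).map (skip a (m + 1)) (skip a (m + 1))) x (a, a + (m + 1))

theorem isGluing_glue (hx : x ∉ l) (hh : ∀ i ∈ l, i ∈ S → (h i).1 ≤ m ∧ (h i).2 ≤ m)
    (g : ι → ℕ × ℕ) : IsGluing x l S a m (glue x S a m g h) g h where
  first := by simp [glue]
  inner i hi hS := by simp [glue, hS, ne_of_mem_of_not_mem hi hx]
  inner_le := hh
  outer i hi hS := by simp [glue, hS, ne_of_mem_of_not_mem hi hx]

theorem isGluing_parts (hxl : x ∉ l) (hf : IsFactorization (m + k + 1) (x :: l) f)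
    (hl : l.length = m + k) (ha : a ≤ k) (hx : f x = (a, a + (m + 1))) :
    IsGluing x l (innerLabels x l f) a m f (outerPart (insert x (innerLabels x l f)) a (m + 1) f)
      (innerPart (innerLabels x l f) a f) := by
  have hS {i} (hi : i ∈ l) :
      i ∈ innerLabels x l f ↔ a < (f i).1 ∧ (f i).1 ≤ a + (m + 1) := by
    simp [innerLabels, hi, hx]
  have hsep {i} (hi : i ∈ l) := hf.mem_Ioc_iff hl ha hx hi
  simp only [Finset.mem_Ioc] at hsep
  refine ⟨hx, fun i hi hiS => ?_, fun i hi hiS => ?_, fun i hi hiS => ?_⟩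
  · have h₁ := (hS hi).1 hiS
    have h₂ := (hsep hi).1 h₁
    ext <;> simp only [innerPart, Finset.piecewise_eq_of_mem _ _ _ hiS, Prod.map_fst,
      Prod.map_snd] <;> omega
  · have h₁ := (hS hi).1 hiS
    have h₂ := (hsep hi).1 h₁
    simp only [innerPart, Finset.piecewise_eq_of_mem _ _ _ hiS, Prod.map_fst, Prod.map_snd]
    omega
  · have h₁ := mt (hS hi).2 hiS
    have h₂ := mt (hsep hi).2 h₁
    have hxS : i ∉ insert x (innerLabels x l f) := by
      simp [ne_of_mem_of_not_mem hi hxl, hiS]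
    ext <;> simp only [outerPart, Finset.piecewise_eq_of_notMem _ _ _ hxS, Prod.map_fst,
      Prod.map_snd, skip_unskip h₁, skip_unskip h₂]

end Gluing

section FactorizationRecursion

variable {ι : Type*} [DecidableEq ι]

/-- The multisets obtained from `μ ∈ A` and `ν ∈ B` by adding to `μ` the elements of `ν`, all of
them increased by `d + 1` for some `d ∈ μ`. If `μ` and `ν` consist of the depths of the vertices
of two rooted trees, this is the effect of joining the second root to a vertex of depth `d` of the
first tree. -/
def grafts (A B : Multiset (Multiset ℕ)) : Multiset (Multiset ℕ) :=
  A.bind fun μ => μ.bind fun d => B.map fun ν => μ + ν.map (· + (d + 1))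

theorem grafts_map {α β γ : Type*} (s : Finset α) (c : Finset γ) (t : Finset β) (d : α → γ → ℕ)
    (Q : β → Multiset ℕ) :
    grafts (s.val.map fun g => c.val.map (d g)) (t.val.map Q) =
      ∑ z ∈ s ×ˢ c ×ˢ t, {c.val.map (d z.1) + (Q z.2.2).map (· + (d z.1 z.2.1 + 1))} := by
  have hB (μ : Multiset ℕ) (j : ℕ) : (t.val.map Q).map (fun ν => μ + ν.map (· + (j + 1))) =
      ∑ h ∈ t, {μ + (Q h).map (· + (j + 1))} := by
    rw [Multiset.map_map, Finset.sum, ← Multiset.sum_map_singleton (Multiset.map _ _),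
      Multiset.map_map]
    rfl
  simp only [grafts, hB, Multiset.bind_map, Finset.sum_product]
  rfl

variable {x : ι} {l : List ι} {S : Finset ι} {a m : ℕ} {f g h : ι → ℕ × ℕ}

theorem isFactorization_cons_length_iff
    (H : IsGluing x l S a (l.filter (· ∈ S)).length f g h)
    (ha : a ≤ (l.filter (· ∉ S)).length) :
    IsFactorization (x :: l).length (x :: l) f ↔
      IsFactorization (l.filter (· ∈ S)).length (l.filter (· ∈ S)) h ∧
        IsFactorization (l.filter (· ∉ S)).length (l.filter (· ∉ S)) g := by
  rw [← H.isFactorization_iff ha, List.length_cons, length_filter_add l S]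

theorem innerLabels_eq (H : IsGluing x l S a m f g h) (hS : S ⊆ l.toFinset) :
    innerLabels x l f = S := by
  ext i
  rw [innerLabels, Finset.mem_filter, List.mem_toFinset]
  exact ⟨fun ⟨hi, hi'⟩ => (H.mem_iff hi).2 hi', fun hi =>
    have hil := List.mem_toFinset.1 (hS hi)
    ⟨hil, (H.mem_iff hil).1 hi⟩⟩

theorem innerPart_eq (H : IsGluing x l S a m f g h) (hS : S ⊆ l.toFinset)
    (hh : ∀ i ∉ l.filter (· ∈ S), h i = 0) : innerPart S a f = h := by
  funext i
  by_cases hiS : i ∈ S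
  · ext <;> simp [innerPart, hiS, H.inner i (List.mem_toFinset.1 (hS hiS)) hiS]
  · simp [innerPart, hiS, hh i (by simp [hiS])]

theorem outerPart_eq (H : IsGluing x l S a m f g h) (hx : x ∉ l) (hf : ∀ i ∉ x :: l, f i = 0)
    (hg : ∀ i ∉ l.filter (· ∉ S), g i = 0) : outerPart (insert x S) a (m + 1) f = g := by
  funext i
  by_cases hiS : i ∈ insert x S
  · have hil : i ∉ l.filter (· ∉ S) := by grind
    simp [outerPart, Finset.piecewise_eq_of_mem _ _ _ hiS, hg i hil]
  have hiS' : i ≠ x ∧ i ∉ S := by simpa using hiS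
  by_cases hil : i ∈ l
  · ext <;> simp [outerPart, hiS'.1, hiS'.2, H.outer i hil hiS'.2, unskip_skip]
  · simp [outerPart, hiS'.1, hiS'.2, hf i (by simp [hiS'.1, hil]), hg i (by simp [hil]),
      map_unskip_zero]

variable [Fintype ι]

open Classical in
/-- The factorizations of the cycle `(0 1 ⋯ l.length)`, labelled by the elements of `l`. -/
def factorizations (l : List ι) : Finset (ι → ℕ × ℕ) :=
  (Fintype.piFinset fun i => if i ∈ l then
    Finset.range (l.length + 1) ×ˢ Finset.range (l.length + 1) else {0}).filter
    (IsFactorization l.length l)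

theorem mem_factorizations :
    f ∈ factorizations l ↔ (∀ i ∉ l, f i = 0) ∧ IsFactorization l.length l f := by
  simp only [factorizations, Finset.mem_filter, Fintype.mem_piFinset]
  refine and_congr_left fun hf => forall_congr' fun i => ?_
  by_cases hi : i ∈ l
  · have := hf.1 i hi
    simp only [hi, if_true, not_true, false_imp_iff, iff_true, Finset.mem_product,
      Finset.mem_range]
    omega
  · simp [hi]

/-- The height profiles of the factorizations labelled by `l`. -/
def heightProfiles (l : List ι) : Multiset (Multiset ℕ) :=
  (factorizations l).val.map (profile l)

theorem glue_mem_factorizations (hx : x ∉ l) (hS : S ⊆ l.toFinset)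
    (hg : g ∈ factorizations (l.filter (· ∉ S))) (ha : a ≤ (l.filter (· ∉ S)).length)
    (hh : h ∈ factorizations (l.filter (· ∈ S))) :
    IsGluing x l S a (l.filter (· ∈ S)).length
        (glue x S a (l.filter (· ∈ S)).length g h) g h ∧
      glue x S a (l.filter (· ∈ S)).length g h ∈ factorizations (x :: l) := by
  rw [mem_factorizations] at hg hh
  have hle : ∀ i ∈ l, i ∈ S → (h i).1 ≤ (l.filter (· ∈ S)).length ∧
      (h i).2 ≤ (l.filter (· ∈ S)).length := by
    intro i hi hiS
    have := hh.2.1 i (by simpa using ⟨hi, hiS⟩)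
    omega
  have H := isGluing_glue (a := a) hx hle g
  refine ⟨H, mem_factorizations.2
    ⟨fun i hi => ?_, (isFactorization_cons_length_iff H ha).2 ⟨hh.2, hg.2⟩⟩⟩
  obtain ⟨hix, hil⟩ : i ≠ x ∧ i ∉ l := by simpa using hi
  have hiS : i ∉ S := fun hiS => hil (List.mem_toFinset.1 (hS hiS))
  simp [glue, hix, hiS, hg.1 i (by simp [hil]), map_skip_zero]

theorem parts_mem_factorizations (hx : x ∉ l) (hf : f ∈ factorizations (x :: l))
    (hS : innerLabels x l f = S) (ha : (f x).1 = a) :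
    IsGluing x l S a (l.filter (· ∈ S)).length f
        (outerPart (insert x S) a ((l.filter (· ∈ S)).length + 1) f) (innerPart S a f) ∧
      outerPart (insert x S) a ((l.filter (· ∈ S)).length + 1) f ∈
        factorizations (l.filter (· ∉ S)) ∧
      a ≤ (l.filter (· ∉ S)).length ∧
      innerPart S a f ∈ factorizations (l.filter (· ∈ S)) := by
  obtain ⟨hzero, hf⟩ := mem_factorizations.1 hf
  obtain ⟨hlt, hle⟩ := hf.1 x List.mem_cons_self
  rw [List.length_cons] at hle hf
  obtain ⟨m, hm⟩ : ∃ m, (f x).2 = a + (m + 1) := ⟨(f x).2 - a - 1, by omega⟩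
  obtain ⟨k, hk⟩ : ∃ k, l.length = m + k := ⟨l.length - m, by omega⟩
  rw [hk] at hf
  have H := isGluing_parts hx hf hk (by omega) (Prod.ext ha hm)
  rw [hS] at H
  obtain ⟨hin, hout⟩ := (H.isFactorization_iff (by omega)).1 hf
  have hlen := length_filter_add l S
  have hin_le := hin.le_length
  have hout_le := hout.le_length
  obtain rfl : m = (l.filter (· ∈ S)).length := by omega
  obtain rfl : k = (l.filter (· ∉ S)).length := by omega
  refine ⟨H, mem_factorizations.2 ⟨fun i hi => ?_, hout⟩, by omega,
    mem_factorizations.2 ⟨fun i hi => ?_, hin⟩⟩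
  · by_cases hiS : i ∈ insert x S
    · simp [outerPart, hiS]
    · have hil : i ∉ x :: l := by grind
      rw [outerPart, Finset.piecewise_eq_of_notMem _ _ _ hiS, hzero i hil, map_unskip_zero]
  · have hiS : i ∉ S := by
      subst hS
      simp only [List.mem_filter, decide_eq_true_eq, innerLabels, Finset.mem_filter,
        List.mem_toFinset] at hi ⊢
      tauto
    simp [innerPart, hiS]

theorem glue_parts (hx : x ∉ l) (hf : f ∈ factorizations (x :: l))
    (hS : innerLabels x l f = S) (ha : (f x).1 = a) :
    glue x S a (l.filter (· ∈ S)).length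
      (outerPart (insert x S) a ((l.filter (· ∈ S)).length + 1) f) (innerPart S a f) = f := by
  obtain ⟨H, -⟩ := parts_mem_factorizations hx hf hS ha
  have hzero := (mem_factorizations.1 hf).1
  funext i
  by_cases hix : i = x
  · subst hix
    rw [H.first]
    simp [glue]
  by_cases hil : i ∈ l
  · by_cases hiS : i ∈ S
    · rw [H.inner i hil hiS]
      simp [glue, hix, hiS]
    · rw [H.outer i hil hiS]
      simp [glue, hix, hiS]
  · have hiS : i ∉ S := by simp [← hS, innerLabels, hil]
    simp [glue, hix, hiS, outerPart, hzero i (by simp [hix, hil]), map_skip_zero, map_unskip_zero]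

theorem heightProfiles_nil : heightProfiles ([] : List ι) = {{0}} := by
  have : factorizations ([] : List ι) = {0} := by
    ext f
    simp [mem_factorizations, IsFactorization, swapProd, cycleMap, funext_iff]
  simp [heightProfiles, this, profile, height_zero]

theorem heightProfiles_eq_map (l : List ι) :
    heightProfiles l = (factorizations l).val.map fun f =>
      (Finset.range (l.length + 1)).val.map fun a => height l f (a + 1) :=
  Multiset.map_congr rfl fun _ hf => (mem_factorizations.1 hf).2.profile_eq

theorem heightProfiles_cons (hx : x ∉ l) :
    heightProfiles (x :: l) = ∑ S ∈ l.toFinset.powerset,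
      grafts (heightProfiles (l.filter (· ∉ S))) (heightProfiles (l.filter (· ∈ S))) := by
  have hgrafts (S : Finset ι) := (congrArg₂ grafts (heightProfiles_eq_map (l.filter (· ∉ S)))
    (rfl : heightProfiles (l.filter (· ∈ S)) = _)).trans (grafts_map _ _ _ _ _)
  simp_rw [hgrafts]
  rw [heightProfiles, ← Multiset.sum_map_singleton (Multiset.map _ _), Multiset.map_map,
    ← Finset.sum, Finset.sum_sigma']
  refine Finset.sum_bij'
    (fun f _ => ⟨innerLabels x l f, outerPart (insert x (innerLabels x l f)) (f x).1
      ((l.filter (· ∈ innerLabels x l f)).length + 1) f, (f x).1,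
      innerPart (innerLabels x l f) (f x).1 f⟩)
    (fun z _ => glue x z.1 z.2.2.1 (l.filter (· ∈ z.1)).length z.2.1 z.2.2.2)
    (fun f hf => ?_) (fun z hz => ?_) (fun f hf => glue_parts hx hf rfl rfl) (fun z hz => ?_)
    (fun f hf => ?_)
  · obtain ⟨-, hg, ha, hh⟩ := parts_mem_factorizations hx hf rfl rfl
    simp only [Finset.mem_sigma, Finset.mem_product, Finset.mem_powerset, Finset.mem_range]
    exact ⟨Finset.filter_subset _ _, hg, Nat.lt_succ_of_le ha, hh⟩
  · simp only [Finset.mem_sigma, Finset.mem_product, Finset.mem_powerset, Finset.mem_range] at hz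
    obtain ⟨hS, hg, ha, hh⟩ := hz
    exact (glue_mem_factorizations hx hS hg (Nat.le_of_lt_succ ha) hh).2
  · obtain ⟨S, g, a, h⟩ := z
    simp only [Finset.mem_sigma, Finset.mem_product, Finset.mem_powerset, Finset.mem_range] at hz
    obtain ⟨hS, hg, ha, hh⟩ := hz
    obtain ⟨H, hf⟩ := glue_mem_factorizations hx hS hg (Nat.le_of_lt_succ ha) hh
    simp only [innerLabels_eq H hS, H.first, innerPart_eq H hS (mem_factorizations.1 hh).1,
      outerPart_eq H hx (mem_factorizations.1 hf).1 (mem_factorizations.1 hg).1]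
  · obtain ⟨H, hg, ha, -⟩ := parts_mem_factorizations hx hf rfl rfl
    simp only [Function.comp_apply]
    rw [H.profile_eq ha]
    congr 2
    exact (mem_factorizations.1 hg).2.profile_eq

end FactorizationRecursion

/-! ### Rooted trees as parent maps -/

section ParentMaps

variable {V : Type*} {r x : V} {L S : Finset V} {p q : V → V} {d e : V → ℕ}

open Classical in
/-- The vertices in `L` from which the parent map `p` leads to `x`. -/
def descendants (x : V) (L : Finset V) (p : V → V) : Finset V :=
  L.filter fun j => ∃ k, p^[k] j = x

theorem mem_descendants {j : V} : j ∈ descendants x L p ↔ j ∈ L ∧ ∃ k, p^[k] j = x := by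
  simp [descendants]

theorem descendants_subset (x : V) (L : Finset V) (p : V → V) : descendants x L p ⊆ L :=
  fun _ hj => (mem_descendants.1 hj).1

variable [DecidableEq V]

/-- The map `p` is the parent map of a tree with root `r` and set of other vertices `L`, in which
the vertex `j` has depth `d j`. Only the values of `p` on `L` matter. -/
def IsDepth (r : V) (L : Finset V) (p : V → V) (d : V → ℕ) : Prop :=
  d r = 0 ∧ ∀ j ∈ L, p j ∈ insert r L ∧ d j = d (p j) + 1

/-- The number of steps that lead from `j` to `r` under the parent map `p`; it is `0` if `r` is
never reached. -/
def depth (r : V) (p : V → V) (j : V) : ℕ := sInf {k | p^[k] j = r}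

namespace IsDepth

theorem congr (h : IsDepth r L p d) (hpq : ∀ j ∈ L, q j = p j) : IsDepth r L q d :=
  ⟨h.1, fun j hj => by rw [hpq j hj]; exact h.2 j hj⟩

theorem root_notMem (h : IsDepth r L p d) : r ∉ L := fun hr => by
  have := (h.2 r hr).2
  have := h.1
  omega

theorem eq_root (h : IsDepth r L p d) {j : V} (hj : j ∈ insert r L) (hd : d j = 0) : j = r :=
  (Finset.mem_insert.1 hj).resolve_right fun hjL => by
    have := (h.2 j hjL).2
    omega

theorem iterate (h : IsDepth r L p d) {j : V} (hj : j ∈ insert r L) :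
    ∀ k ≤ d j, p^[k] j ∈ insert r L ∧ d (p^[k] j) + k = d j
  | 0, _ => ⟨hj, rfl⟩
  | k + 1, hk => by
    obtain ⟨hmem, hd⟩ := h.iterate hj k (Nat.le_of_succ_le hk)
    have hroot : p^[k] j ≠ r := fun heq => by
      rw [heq, h.1] at hd
      omega
    obtain ⟨hmem', hd'⟩ := h.2 _ (Finset.mem_of_mem_insert_of_ne hmem hroot)
    rw [Function.iterate_succ_apply']
    exact ⟨hmem', by omega⟩

theorem iterate_eq_root (h : IsDepth r L p d) {j : V} (hj : j ∈ insert r L) :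
    p^[d j] j = r := by
  obtain ⟨hmem, hd⟩ := h.iterate hj (d j) le_rfl
  exact h.eq_root hmem (by omega)

theorem depth_eq (h : IsDepth r L p d) {j : V} (hj : j ∈ insert r L) : depth r p j = d j := by
  refine IsLeast.csInf_eq ⟨h.iterate_eq_root hj, fun k (hk : p^[k] j = r) => ?_⟩
  by_contra! hlt
  have := (h.iterate hj k hlt.le).2
  rw [hk, h.1] at this
  omega

theorem isDepth_depth (h : IsDepth r L p d) : IsDepth r L p (depth r p) :=
  ⟨by rw [h.depth_eq (Finset.mem_insert_self r L), h.1], fun j hj => ⟨(h.2 j hj).1, by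
    rw [h.depth_eq (Finset.mem_insert_of_mem hj), h.depth_eq (h.2 j hj).1, (h.2 j hj).2]⟩⟩

theorem iterate_le (h : IsDepth r L p d) (hp : ∀ j ∉ L, p j = j) (j : V) (k : ℕ) :
    d (p^[k] j) ≤ d j := by
  induction k with
  | zero => rfl
  | succ k ih =>
    rw [Function.iterate_succ_apply']
    refine le_trans ?_ ih
    by_cases hj : p^[k] j ∈ L
    · exact (h.2 _ hj).2 ▸ Nat.le_succ _
    · rw [hp _ hj]

theorem graft (hd : IsDepth r (L \ S) p d) (he : IsDepth x S p e) (hxL : x ∉ L) (hxr : x ≠ r)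
    (hrL : r ∉ L) (hS : S ⊆ L) (hpx : p x ∈ insert r (L \ S)) :
    IsDepth r (insert x L) p fun j =>
      if j ∈ insert x S then e j + (d (p x) + 1) else d j := by
  have houter {j : V} (hj : j ∈ insert r (L \ S)) : j ∉ insert x S := by grind
  refine ⟨(if_neg (houter (Finset.mem_insert_self _ _))).trans hd.1, fun j hj => ?_⟩
  rcases Finset.mem_insert.1 hj with rfl | hjL
  · simp only [Finset.mem_insert_self, if_true, if_neg (houter hpx), he.1, zero_add, and_true]
    grind
  · by_cases hjS : j ∈ S
    · obtain ⟨hmem, heq⟩ := he.2 j hjS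
      simp only [Finset.mem_insert_of_mem hjS, hmem, if_true, heq]
      grind
    · obtain ⟨hmem, heq⟩ := hd.2 j (Finset.mem_sdiff.2 ⟨hjL, hjS⟩)
      have hjx : j ∉ insert x S := houter (by grind)
      simp only [if_neg hjx, if_neg (houter hmem), heq, and_true]
      grind

end IsDepth

theorem descendants_eq (hd : IsDepth r (L \ S) p d) (he : IsDepth x S p e) (hpr : p r = r)
    (hxL : x ∉ L) (hxr : x ≠ r) (hS : S ⊆ L) : descendants x L p = S := by
  have hmaps : Set.MapsTo p (insert r (L \ S) : Finset V) (insert r (L \ S) : Finset V) :=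
    fun j hj => by
      rcases Finset.mem_insert.1 hj with rfl | hj
      exacts [by simp [hpr], (hd.2 j hj).1]
  ext j
  rw [mem_descendants]
  refine ⟨fun ⟨hjL, k, hk⟩ => ?_, fun hj => ⟨hS hj, e j, ?_⟩⟩
  · by_contra hjS
    have : x ∈ insert r (L \ S) := hk ▸ hmaps.iterate k (by simp [hjL, hjS])
    grind
  · exact he.iterate_eq_root (Finset.mem_insert_of_mem hj)

theorem parent_mem_descendants {j : V} (hj : p j ∈ L ∨ p j = x) (hpj : ∃ k, p^[k + 1] j = x) :
    p j ∈ insert x (descendants x L p) := by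
  obtain ⟨k, hk⟩ := hpj
  rcases hj with hj | hj
  · exact Finset.mem_insert_of_mem (mem_descendants.2 ⟨hj, k, hk⟩)
  · exact hj ▸ Finset.mem_insert_self _ _

section Split

variable (hp : ∀ j ∉ insert x L, p j = j) (hd : IsDepth r (insert x L) p d)
include hd

theorem isDepth_sdiff_descendants : IsDepth r (L \ descendants x L p) p d := by
  refine ⟨hd.1, fun j hj => ⟨?_, (hd.2 j (by grind)).2⟩⟩
  have hmem := (hd.2 j (by grind)).1
  obtain ⟨hjL, hj⟩ := Finset.mem_sdiff.1 hj
  have hnot (k : ℕ) : p^[k] j ≠ x := fun hk => hj (mem_descendants.2 ⟨hjL, k, hk⟩)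
  have h₁ : p j ≠ x := hnot 1
  have h₂ : p j ∉ descendants x L p := fun h => by
    obtain ⟨-, k, hk⟩ := mem_descendants.1 h
    exact hnot (k + 1) hk
  grind

include hp

theorem isDepth_descendants (hxL : x ∉ L) (hxr : x ≠ r) :
    IsDepth x (descendants x L p) p fun j => d j - d x := by
  have hpr : p r = r := hp r hd.root_notMem
  refine ⟨Nat.sub_self _, fun j hj => ?_⟩
  obtain ⟨hjL, k, hk⟩ := mem_descendants.1 hj
  obtain ⟨hmem, heq⟩ := hd.2 j (Finset.mem_insert_of_mem hjL)
  obtain _ | k := k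
  · exact absurd (hk ▸ hjL) hxL
  have hle : d x ≤ d (p j) := by
    rw [← hk]
    exact hd.iterate_le hp _ k
  have hne : p j ≠ r := fun h => by
    rw [Function.iterate_succ_apply, h, Function.iterate_fixed hpr] at hk
    exact hxr hk.symm
  exact ⟨parent_mem_descendants (by grind) ⟨k, hk⟩, by dsimp only; omega⟩

theorem parent_mem_sdiff_descendants : p x ∈ insert r (L \ descendants x L p) := by
  obtain ⟨hmem, heq⟩ := hd.2 x (Finset.mem_insert_self x L)
  have hnot (k : ℕ) : p^[k] (p x) ≠ x := fun hk => by
    have := hd.iterate_le hp (p x) k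
    rw [hk] at this
    omega
  have h₁ : p x ≠ x := hnot 0
  have h₂ : p x ∉ descendants x L p := fun h => by
    obtain ⟨-, k, hk⟩ := mem_descendants.1 h
    exact hnot k hk
  grind

end Split

theorem map_depth_insert (hd : IsDepth r (L \ S) p d) (he : IsDepth x S p e) (hxL : x ∉ L)
    (hxr : x ≠ r) (hrL : r ∉ L) (hS : S ⊆ L) (hpx : p x ∈ insert r (L \ S)) :
    (insert r (insert x L)).val.map (depth r p) =
      (insert r (L \ S)).val.map (depth r ((L \ S).piecewise p id)) +
      ((insert x S).val.map (depth x (S.piecewise p id))).map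
        (· + (depth r ((L \ S).piecewise p id) (p x) + 1)) := by
  have hdisj : Disjoint (insert r (L \ S)) (insert x S) := by
    rw [Finset.disjoint_left]
    grind
  have hunion : insert r (insert x L) = (insert r (L \ S)).disjUnion (insert x S) hdisj := by
    rw [Finset.disjUnion_eq_union]
    grind
  have hgraft := hd.graft he hxL hxr hrL hS hpx
  have hd' := hd.congr fun j hj => Finset.piecewise_eq_of_mem _ p id hj
  have he' := he.congr fun j hj => Finset.piecewise_eq_of_mem _ p id hj
  rw [hunion, Finset.disjUnion_val, Multiset.map_add, Multiset.map_map]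
  refine congrArg₂ _ (Multiset.map_congr rfl fun j hj => ?_)
    (Multiset.map_congr rfl fun j hj => ?_)
  · rw [Finset.mem_val] at hj
    rw [hgraft.depth_eq (hunion ▸ Finset.mem_disjUnion.2 (.inl hj)), hd'.depth_eq hj,
      if_neg (Finset.disjoint_left.1 hdisj hj)]
  · rw [Finset.mem_val] at hj
    rw [hgraft.depth_eq (hunion ▸ Finset.mem_disjUnion.2 (.inr hj)), if_pos hj,
      Function.comp_apply, hd'.depth_eq hpx, he'.depth_eq hj]

/-- The parent map of the tree obtained by joining the root `x` of the tree with the set of other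
vertices `S` and parent map `q` to the vertex `v` of the tree with parent map `p`. -/
def joinTrees (x : V) (S : Finset V) (p : V → V) (v : V) (q : V → V) : V → V :=
  Function.update (S.piecewise q p) x v

theorem joinTrees_piecewise (hp : ∀ j ∉ insert x L, p j = j) (S : Finset V) :
    joinTrees x S ((L \ S).piecewise p id) (p x) (S.piecewise p id) = p := by
  funext j
  by_cases hjx : j = x
  · simp [joinTrees, hjx]
  by_cases hjS : j ∈ S
  · simp [joinTrees, hjx, hjS]
  by_cases hjL : j ∈ L
  · simp [joinTrees, hjx, hjS, hjL]
  · simp [joinTrees, hjx, hjS, hjL, hp j (by simp [hjx, hjL])]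

theorem piecewise_joinTrees (hxL : x ∉ L) (hS : S ⊆ L) (hp : ∀ j ∉ L \ S, p j = j) (v : V)
    (hq : ∀ j ∉ S, q j = j) :
    (L \ S).piecewise (joinTrees x S p v q) id = p ∧ joinTrees x S p v q x = v ∧
      S.piecewise (joinTrees x S p v q) id = q := by
  refine ⟨funext fun j => ?_, by simp [joinTrees], funext fun j => ?_⟩
  · by_cases hj : j ∈ L \ S
    · obtain ⟨hjL, hjS⟩ := Finset.mem_sdiff.1 hj
      simp [joinTrees, hjL, hjS, ne_of_mem_of_not_mem hjL hxL]
    · rw [Finset.piecewise_eq_of_notMem _ _ _ hj, hp j hj, id]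
  · by_cases hj : j ∈ S
    · simp [joinTrees, hj, ne_of_mem_of_not_mem (hS hj) hxL]
    · rw [Finset.piecewise_eq_of_notMem _ _ _ hj, hq j hj, id]

variable [Fintype V]

open Classical in
/-- The trees with root `r` and set of other vertices `L`, given by their parent maps, which are
extended to the other elements of `V` by the identity. -/
def parentMaps (r : V) (L : Finset V) : Finset (V → V) :=
  Finset.univ.filter fun p => (∀ j ∉ L, p j = j) ∧ IsDepth r L p (depth r p)

theorem mem_parentMaps :
    p ∈ parentMaps r L ↔ (∀ j ∉ L, p j = j) ∧ IsDepth r L p (depth r p) := by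
  simp [parentMaps]

/-- The multisets of the depths of the vertices of the trees with root `r` and set of other
vertices `L`. -/
def depthProfiles (r : V) (L : Finset V) : Multiset (Multiset ℕ) :=
  (parentMaps r L).val.map fun p => (insert r L).val.map (depth r p)

theorem depthProfiles_empty (r : V) : depthProfiles r ∅ = {{0}} := by
  have hdepth : depth r id r = 0 := by simp [depth]
  have : parentMaps r ∅ = {id} := by
    ext p
    simp only [mem_parentMaps, Finset.mem_singleton, IsDepth]
    refine ⟨fun h => funext fun j => h.1 j (Finset.notMem_empty j), ?_⟩
    rintro rfl
    simp [hdepth]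
  simp [depthProfiles, this, hdepth]

theorem piecewise_mem_parentMaps (h : IsDepth r L p d) : L.piecewise p id ∈ parentMaps r L :=
  mem_parentMaps.2 ⟨fun j hj => by simp [hj],
    (h.congr fun j hj => Finset.piecewise_eq_of_mem _ _ _ hj).isDepth_depth⟩

theorem joinTrees_mem_parentMaps_and_descendants_eq (hxL : x ∉ L) (hxr : x ≠ r) (hrL : r ∉ L)
    (hS : S ⊆ L) {v : V} (hp : p ∈ parentMaps r (L \ S)) (hv : v ∈ insert r (L \ S))
    (hq : q ∈ parentMaps x S) :
    joinTrees x S p v q ∈ parentMaps r (insert x L) ∧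
      descendants x L (joinTrees x S p v q) = S := by
  rw [mem_parentMaps] at hp hq
  have hd : IsDepth r (L \ S) (joinTrees x S p v q) (depth r p) :=
    hp.2.congr fun j hj => by
      obtain ⟨hjL, hjS⟩ := Finset.mem_sdiff.1 hj
      simp [joinTrees, hjS, ne_of_mem_of_not_mem hjL hxL]
  have he : IsDepth x S (joinTrees x S p v q) (depth x q) :=
    hq.2.congr fun j hj => by
      simp [joinTrees, hj, ne_of_mem_of_not_mem (hS hj) hxL]
  have hout (j : V) (hj : j ∉ insert x L) : joinTrees x S p v q j = j := by
    have hjS : j ∉ S := fun h => hj (Finset.mem_insert_of_mem (hS h))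
    obtain ⟨hjx, hjL⟩ : j ≠ x ∧ j ∉ L := by simpa using hj
    simp [joinTrees, hjx, hjS, hp.1 j (by simp [hjL])]
  have hvx : joinTrees x S p v q x ∈ insert r (L \ S) := by simpa [joinTrees] using hv
  exact ⟨mem_parentMaps.2 ⟨hout, (hd.graft he hxL hxr hrL hS hvx).isDepth_depth⟩,
    descendants_eq hd he (hout r (by simp [hxr.symm, hrL])) hxL hxr hS⟩

theorem depthProfiles_insert (hxL : x ∉ L) (hxr : x ≠ r) (hrL : r ∉ L) :
    depthProfiles r (insert x L) = ∑ S ∈ L.powerset,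
      grafts (depthProfiles r (L \ S)) (depthProfiles x S) := by
  simp_rw [depthProfiles, grafts_map]
  rw [← Multiset.sum_map_singleton (Multiset.map _ _), Multiset.map_map, ← Finset.sum,
    Finset.sum_sigma']
  refine Finset.sum_bij'
    (fun p _ => ⟨descendants x L p, (L \ descendants x L p).piecewise p id, p x,
      (descendants x L p).piecewise p id⟩)
    (fun z _ => joinTrees x z.1 z.2.1 z.2.2.1 z.2.2.2)
    (fun p hp => ?_) (fun z hz => ?_) (fun p hp => ?_) (fun z hz => ?_) (fun p hp => ?_)
  · obtain ⟨hp, hd⟩ := mem_parentMaps.1 hp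
    simp only [Finset.mem_sigma, Finset.mem_product, Finset.mem_powerset]
    exact ⟨descendants_subset x L p,
      piecewise_mem_parentMaps (isDepth_sdiff_descendants hd),
      parent_mem_sdiff_descendants hp hd,
      piecewise_mem_parentMaps (isDepth_descendants hp hd hxL hxr)⟩
  · simp only [Finset.mem_sigma, Finset.mem_product, Finset.mem_powerset] at hz
    obtain ⟨hS, hp, hv, hq⟩ := hz
    exact (joinTrees_mem_parentMaps_and_descendants_eq hxL hxr hrL hS hp hv hq).1
  · exact joinTrees_piecewise (mem_parentMaps.1 hp).1 _
  · obtain ⟨S, p, v, q⟩ := z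
    simp only [Finset.mem_sigma, Finset.mem_product, Finset.mem_powerset] at hz
    obtain ⟨hS, hp, hv, hq⟩ := hz
    obtain ⟨hpeq, hxv, hqeq⟩ := piecewise_joinTrees hxL hS (mem_parentMaps.1 hp).1 v
      (mem_parentMaps.1 hq).1
    dsimp only
    rw [(joinTrees_mem_parentMaps_and_descendants_eq hxL hxr hrL hS hp hv hq).2, hpeq, hxv, hqeq]
  · obtain ⟨hp, hd⟩ := mem_parentMaps.1 hp
    simp only [Function.comp_apply]
    rw [map_depth_insert (isDepth_sdiff_descendants hd)
      (isDepth_descendants hp hd hxL hxr) hxL hxr hrL (descendants_subset x L p)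
      (parent_mem_sdiff_descendants hp hd)]

end ParentMaps

/-! ### Equality of the profiles -/

theorem heightProfiles_eq_depthProfiles {ι V : Type*} [DecidableEq ι] [Fintype ι] [DecidableEq V]
    [Fintype V] {e : ι → V} (he : e.Injective) (l : List ι) (hl : l.Nodup) (r : V)
    (hr : r ∉ l.toFinset.image e) : heightProfiles l = depthProfiles r (l.toFinset.image e) := by
  match l with
  | [] => simp [heightProfiles_nil, depthProfiles_empty]
  | x :: l =>
    obtain ⟨hxl, hl⟩ := List.nodup_cons.1 hl
    have hex : e x ∉ l.toFinset.image e := by simpa [he.eq_iff] using hxl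
    simp only [List.toFinset_cons, Finset.image_insert, Finset.mem_insert, not_or] at hr ⊢
    rw [heightProfiles_cons hxl, depthProfiles_insert hex (Ne.symm hr.1) hr.2,
      Finset.powerset_image, Finset.sum_image (Finset.image_injective he).injOn]
    refine Finset.sum_congr rfl fun S hS => ?_
    have hin : (l.filter (· ∈ S)).toFinset = S := by
      ext i
      simpa using @Finset.mem_powerset.1 hS i
    have hout : (l.filter (· ∉ S)).toFinset = l.toFinset \ S := by
      ext i
      simp
    rw [← Finset.image_sdiff _ _ he, heightProfiles_eq_depthProfiles he (l.filter (· ∉ S))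
      (hl.filter _) r (by grind), heightProfiles_eq_depthProfiles he (l.filter (· ∈ S))
      (hl.filter _) (e x) (by grind), hin, hout]
termination_by l.length
decreasing_by
  all_goals exact Nat.lt_succ_of_le (List.length_filter_le _ _)

/-! ### Minimal factorizations of the full cycle -/

section MinimalFactorizations

variable {n : ℕ} {t : Fin n → Equiv.Perm (Fin (n + 1))}

theorem lower_lt_upper {τ : Equiv.Perm (Fin (n + 1))} (h : τ.IsSwap) : lower τ < upper τ := by
  obtain ⟨a, b, hab, rfl⟩ := h
  rcases hab.lt_or_gt with h | h
  · rwa [lower_swap h, upper_swap h]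
  · rwa [Equiv.swap_comm, lower_swap h, upper_swap h]

theorem swap_lower_upper {τ : Equiv.Perm (Fin (n + 1))} (h : τ.IsSwap) :
    Equiv.swap (lower τ) (upper τ) = τ := by
  obtain ⟨a, b, hab, rfl⟩ := h
  rcases hab.lt_or_gt with h | h
  · rw [lower_swap h, upper_swap h]
  · rw [Equiv.swap_comm a, lower_swap h, upper_swap h]

theorem swapProd_map_lower_upper {s : List (Equiv.Perm (Fin (n + 1)))} (h : ∀ τ ∈ s, τ.IsSwap) :
    swapProd (s.map fun τ => (lower τ, upper τ)) = s.reverse.prod := by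
  rw [swapProd, List.map_map]
  exact congrArg (fun l => l.reverse.prod)
    ((List.map_congr_left fun τ hτ => swap_lower_upper (h τ hτ)).trans (List.map_id s))

/-- The sequence of pairs `(a, b)`, where `a < b`, of a sequence of transpositions `(a b)`. -/
def swapPairs (t : Fin n → Equiv.Perm (Fin (n + 1))) (i : Fin n) : ℕ × ℕ :=
  (lower (t i), upper (t i))

theorem swapPairs_swap {i : Fin n} {a b : Fin (n + 1)} (hab : a < b)
    (h : t i = Equiv.swap a b) : swapPairs t i = (↑a, ↑b) := by
  rw [swapPairs, h, lower_swap hab, upper_swap hab]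

theorem val_finRotate (x : Fin (n + 1)) : (finRotate (n + 1) x : ℕ) = cycleMap n x := by
  rcases eq_or_ne x (Fin.last n) with rfl | h
  · simp [cycleMap]
  · rw [coe_finRotate_of_ne_last h, cycleMap, if_pos (Fin.val_lt_last h)]

theorem swapProd_swapPairs (ht : ∀ i, (t i).IsSwap) (x : Fin (n + 1)) :
    swapProd ((List.finRange n).map (swapPairs t)) x = leftToRightProd t x := by
  rw [leftToRightProd, ← swapProd_map_lower_upper (by simpa [List.mem_ofFn'] using ht),
    ← swapProd_map Fin.val_injective, List.ofFn_eq_map, List.map_map, List.map_map]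
  rfl

theorem leftToRightProd_eq_finRotate_iff (ht : ∀ i, (t i).IsSwap) :
    leftToRightProd t = finRotate (n + 1) ↔
      ∀ x ≤ n, swapProd ((List.finRange n).map (swapPairs t)) x = cycleMap n x := by
  rw [Equiv.ext_iff, Fin.forall_iff]
  simp only [Nat.lt_succ_iff, Fin.ext_iff, val_finRotate, ← swapProd_swapPairs ht]

theorem mem_minimalFactorizations : t ∈ minimalFactorizations n ↔
    (∀ i, (t i).IsSwap) ∧ leftToRightProd t = finRotate (n + 1) := by
  simp [minimalFactorizations]

theorem swapPairs_mem_factorizations_iff (ht : ∀ i, (t i).IsSwap) :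
    swapPairs t ∈ factorizations (List.finRange n) ↔ t ∈ minimalFactorizations n := by
  have hpairs (i : Fin n) : (swapPairs t i).1 < (swapPairs t i).2 ∧ (swapPairs t i).2 ≤ n :=
    ⟨lower_lt_upper (ht i), Nat.lt_succ_iff.1 (upper (t i)).2⟩
  simp [mem_factorizations, IsFactorization, mem_minimalFactorizations, ht, hpairs,
    leftToRightProd_eq_finRotate_iff]

theorem exists_swapPairs_eq {f : Fin n → ℕ × ℕ} (hf : ∀ i, (f i).1 < (f i).2 ∧ (f i).2 ≤ n) :
    ∃ t : Fin n → Equiv.Perm (Fin (n + 1)), (∀ i, (t i).IsSwap) ∧ swapPairs t = f := by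
  let a (i : Fin n) : Fin (n + 1) := ⟨(f i).1, by have := hf i; omega⟩
  let b (i : Fin n) : Fin (n + 1) := ⟨(f i).2, by have := hf i; omega⟩
  have hab (i : Fin n) : a i < b i := (hf i).1
  exact ⟨fun i => Equiv.swap (a i) (b i), fun i => ⟨a i, b i, (hab i).ne, rfl⟩,
    funext fun i => swapPairs_swap (hab i) rfl⟩

theorem factorizations_finRange :
    (factorizations (List.finRange n)).val = (minimalFactorizations n).val.map swapPairs := by
  have hswap {t} (ht : t ∈ minimalFactorizations n) := (mem_minimalFactorizations.1 ht).1
  have hinj : Set.InjOn swapPairs (minimalFactorizations n : Set (Fin n → _)) :=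
    fun t ht t' ht' h => funext fun i => by
      obtain ⟨hlower, hupper⟩ := Prod.ext_iff.1 (congrFun h i)
      rw [← swap_lower_upper (hswap ht i), ← swap_lower_upper (hswap ht' i),
        Fin.ext hlower, Fin.ext hupper]
  rw [← Finset.image_val_of_injOn hinj]
  congr 1
  ext f
  rw [Finset.mem_image]
  refine ⟨fun hf => ?_, ?_⟩
  · obtain ⟨t, ht, rfl⟩ := exists_swapPairs_eq (f := f)
      (by simpa using (mem_factorizations.1 hf).2.1)
    exact ⟨t, (swapPairs_mem_factorizations_iff ht).1 hf, rfl⟩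
  · rintro ⟨t, ht, rfl⟩
    exact (swapPairs_mem_factorizations_iff (hswap ht)).2 ht

theorem map_totalDifference : (minimalFactorizations n).val.map totalDifference =
    (heightProfiles (List.finRange n)).map Multiset.sum := by
  rw [heightProfiles, factorizations_finRange, Multiset.map_map, Multiset.map_map]
  refine Multiset.map_congr rfl fun t _ => ?_
  rw [Function.comp_apply, Function.comp_apply, sum_profile, totalDifference, Fin.sum_univ_def]
  · rfl
  · intro i _
    rw [List.length_finRange]
    exact Nat.lt_succ_iff.1 (upper (t i)).2

end MinimalFactorizations

/-! ### Labelled trees -/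

section Trees

variable {V : Type*}

/-- The graph with the edges `{j, p j}`, where `p j ≠ j`. -/
def parentGraph (p : V → V) : SimpleGraph V := SimpleGraph.fromRel fun i j => p i = j

theorem parentGraph_adj {p : V → V} {i j : V} :
    (parentGraph p).Adj i j ↔ i ≠ j ∧ (p i = j ∨ p j = i) := SimpleGraph.fromRel_adj _ _ _

variable [Fintype V] [DecidableEq V] {r : V} {p : V → V} {d : V → ℕ}

namespace IsDepth

theorem eq_succ (h : IsDepth r {r}ᶜ p d) {j : V} (hj : j ≠ r) : d j = d (p j) + 1 :=
  (h.2 j (by simpa using hj)).2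

theorem parentGraph_adj_parent (h : IsDepth r {r}ᶜ p d) {j : V} (hj : j ≠ r) :
    (parentGraph p).Adj (p j) j := by
  refine parentGraph_adj.2 ⟨fun hpj => ?_, Or.inr rfl⟩
  have := h.eq_succ hj
  rw [hpj] at this
  omega

theorem exists_walk_length_eq (h : IsDepth r {r}ᶜ p d) (j : V) :
    ∃ w : (parentGraph p).Walk r j, w.length = d j := by
  induction hk : d j generalizing j with
  | zero =>
    obtain rfl : j = r := h.eq_root (by simp) hk
    exact ⟨.nil, rfl⟩
  | succ k ih =>
    have hjr : j ≠ r := fun hj => by simp [hj, h.1] at hk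
    obtain ⟨w, hw⟩ := ih (p j) (by have := h.eq_succ hjr; omega)
    exact ⟨w.concat (h.parentGraph_adj_parent hjr), by simp [hw]⟩

theorem parentGraph_connected (h : IsDepth r {r}ᶜ p d) : (parentGraph p).Connected :=
  SimpleGraph.connected_iff_exists_forall_reachable _ |>.2
    ⟨r, fun j => (h.exists_walk_length_eq j).choose.reachable⟩

theorem parent_of_adj (h : IsDepth r {r}ᶜ p d) (hr : p r = r) {i j : V}
    (hij : (parentGraph p).Adj i j) : p i = j ∧ d i = d j + 1 ∨ p j = i ∧ d j = d i + 1 := by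
  obtain ⟨hne, rfl | rfl⟩ := parentGraph_adj.1 hij
  · exact Or.inl ⟨rfl, h.eq_succ fun hi => hne (by rw [hi, hr])⟩
  · exact Or.inr ⟨rfl, h.eq_succ fun hj => hne (by rw [hj, hr])⟩

theorem le_add_length (h : IsDepth r {r}ᶜ p d) (hr : p r = r) {i j : V}
    (w : (parentGraph p).Walk i j) : d j ≤ d i + w.length := by
  induction w with
  | nil => simp
  | cons hadj w ih =>
    have := h.parent_of_adj hr hadj
    rw [SimpleGraph.Walk.length_cons]
    omega

theorem parentGraph_dist (h : IsDepth r {r}ᶜ p d) (hr : p r = r) (j : V) :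
    (parentGraph p).dist r j = d j := by
  apply le_antisymm
  · obtain ⟨w, hw⟩ := h.exists_walk_length_eq j
    exact hw ▸ SimpleGraph.dist_le w
  · obtain ⟨w, hw⟩ := h.parentGraph_connected.exists_walk_length_eq_dist r j
    simpa [h.1, hw] using h.le_add_length hr w

theorem parentGraph_isTree (h : IsDepth r {r}ᶜ p d) (hr : p r = r) : (parentGraph p).IsTree := by
  have hc := h.parentGraph_connected
  refine SimpleGraph.isTree_iff_connected_and_card.2
    ⟨hc, le_antisymm ?_ hc.card_vert_le_card_edgeSet_add_one⟩
  have hsub : (parentGraph p).edgeSet ⊆ (({r}ᶜ : Finset V).image fun j => s(p j, j)) := fun e => by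
    induction e with
    | _ i j =>
      intro hij
      have hne : i ≠ j := (parentGraph_adj.1 hij).1
      rw [Finset.mem_coe, Finset.mem_image]
      obtain ⟨hpi, -⟩ | ⟨hpj, -⟩ : p i = j ∧ _ ∨ p j = i ∧ _ := h.parent_of_adj hr hij
      · exact ⟨i, by simpa using fun hi => hne (by rw [← hpi, hi, hr]), hpi ▸ Sym2.eq_swap⟩
      · exact ⟨j, by simpa using fun hj => hne (by rw [← hpj, hj, hr]), hpj ▸ rfl⟩
  calc Nat.card (parentGraph p).edgeSet + 1
      ≤ (({r}ᶜ : Finset V).image fun j => s(p j, j)).card + 1 := by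
        simpa using Nat.card_mono (Finset.finite_toSet _) hsub
    _ ≤ ({r}ᶜ : Finset V).card + 1 := Nat.add_le_add_right Finset.card_image_le 1
    _ = Nat.card V := by
        rw [← Finset.card_singleton r, Finset.card_compl_add_card, Nat.card_eq_fintype_card]

end IsDepth

theorem mem_parentMaps_compl :
    p ∈ parentMaps r {r}ᶜ ↔ p r = r ∧ IsDepth r {r}ᶜ p (depth r p) := by
  simp [mem_parentMaps]

theorem parentGraph_injOn : Set.InjOn parentGraph (parentMaps r {r}ᶜ : Set (V → V)) := by
  intro p hp q hq hpq
  obtain ⟨hpr, hp⟩ := mem_parentMaps_compl.1 hp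
  obtain ⟨hqr, hq⟩ := mem_parentMaps_compl.1 hq
  have hdepth (j : V) : depth r p j = depth r q j := by
    rw [← hp.parentGraph_dist hpr, hpq, hq.parentGraph_dist hqr]
  funext j
  by_cases hj : j = r
  · rw [hj, hpr, hqr]
  · have hadj := hp.parentGraph_adj_parent hj
    rw [hpq] at hadj
    rcases hq.parent_of_adj hqr hadj with ⟨-, hd⟩ | ⟨hqj, -⟩
    · have := hp.eq_succ hj
      rw [← hdepth, ← hdepth] at hd
      omega
    · exact hqj.symm

omit [Fintype V] [DecidableEq V] in
theorem exists_adj_dist_eq_succ {T : SimpleGraph V} (hT : T.IsTree) {j : V} (hj : j ≠ r) :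
    ∃ i, T.Adj j i ∧ T.dist r j = T.dist r i + 1 := by
  obtain ⟨w, hw⟩ := hT.connected.exists_walk_length_eq_dist j r
  cases w with
  | nil => exact absurd rfl hj
  | @cons _ i _ hji w =>
    have hle := SimpleGraph.dist_le w
    rw [SimpleGraph.Walk.length_cons, SimpleGraph.dist_comm] at hw
    rw [SimpleGraph.dist_comm] at hle
    refine ⟨i, hji, ?_⟩
    rcases hT.dist_eq_dist_add_one_of_adj r hji with h | h <;> omega

theorem exists_parentGraph_eq {T : SimpleGraph V} (hT : T.IsTree) (r : V) :
    ∃ p ∈ parentMaps r {r}ᶜ, parentGraph p = T := by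
  have hparent (j : V) : ∃ i, if j = r then i = r else T.Adj j i ∧ T.dist r j = T.dist r i + 1 := by
    split_ifs with hj
    exacts [⟨r, rfl⟩, exists_adj_dist_eq_succ hT hj]
  choose p hp using hparent
  have hr : p r = r := by simpa using hp r
  have hp {j : V} (hj : j ≠ r) : T.Adj j (p j) ∧ T.dist r j = T.dist r (p j) + 1 := by
    simpa [hj] using hp j
  have hd : IsDepth r {r}ᶜ p (T.dist r) :=
    ⟨SimpleGraph.dist_self, fun j hj => ⟨by simp, (hp (by simpa using hj)).2⟩⟩
  refine ⟨p, mem_parentMaps_compl.2 ⟨hr, hd.isDepth_depth⟩, ?_⟩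
  refine (SimpleGraph.isTree_iff_minimal_connected.1 hT).eq_of_le hd.parentGraph_connected ?_
  intro i j hij
  have hne := (parentGraph_adj.1 hij).1
  rcases hd.parent_of_adj hr hij with ⟨rfl, -⟩ | ⟨rfl, -⟩
  · exact (hp fun hi => hne (by rw [hi, hr])).1
  · exact (hp fun hj => hne (by rw [hj, hr])).1.symm

end Trees

section LabelledTrees

variable {n : ℕ}

theorem mem_labelledTrees {T : SimpleGraph (Fin (n + 1))} : T ∈ labelledTrees n ↔ T.IsTree := by
  simp [labelledTrees]

theorem image_parentGraph [DecidableEq (SimpleGraph (Fin (n + 1)))] :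
    (parentMaps (0 : Fin (n + 1)) {0}ᶜ).image parentGraph = labelledTrees n := by
  ext T
  rw [Finset.mem_image, mem_labelledTrees]
  refine ⟨?_, fun hT => exists_parentGraph_eq hT 0⟩
  rintro ⟨p, hp, rfl⟩
  obtain ⟨hr, hd⟩ := mem_parentMaps_compl.1 hp
  exact hd.parentGraph_isTree hr

theorem map_totalDepth :
    (labelledTrees n).val.map totalDepth =
      (depthProfiles (0 : Fin (n + 1)) {0}ᶜ).map Multiset.sum := by
  classical
  rw [← image_parentGraph, Finset.image_val_of_injOn parentGraph_injOn, depthProfiles,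
    Multiset.map_map, Multiset.map_map]
  refine Multiset.map_congr rfl fun p hp => ?_
  obtain ⟨hr, hd⟩ := mem_parentMaps_compl.1 (Finset.mem_def.2 hp)
  simp only [Function.comp_apply, totalDepth, hd.parentGraph_dist hr, Finset.insert_compl_self]
  rfl

open Classical in
theorem card_isDescendant {T : SimpleGraph (Fin (n + 1))} (hT : T.IsTree) (j : Fin (n + 1)) :
    (Finset.univ.filter fun i => IsDescendant T i j).card = T.dist 0 j := by
  obtain ⟨w, hw, hlength⟩ := hT.connected.exists_path_of_dist j 0
  have hsupport : (Finset.univ.filter fun i => IsDescendant T i j) =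
      w.support.toFinset.erase j := by
    ext i
    rw [Finset.mem_filter_univ, Finset.mem_erase, List.mem_toFinset, IsDescendant]
    refine and_congr_right fun _ => ⟨?_, fun hi => ⟨w, hw, hi⟩⟩
    rintro ⟨w', hw', hi⟩
    rwa [(hT.existsUnique_path j 0).unique hw hw']
  rw [hsupport, Finset.card_erase_of_mem (by simp),
    List.toFinset_card_of_nodup hw.support_nodup, SimpleGraph.Walk.length_support, hlength,
    SimpleGraph.dist_comm, Nat.add_sub_cancel]

open Classical in
theorem inv_add_coinv_eq_card (T : SimpleGraph (Fin (n + 1))) :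
    inv T + coinv T = (Finset.univ.filter fun ij : Fin (n + 1) × Fin (n + 1) =>
      IsDescendant T ij.1 ij.2).card := by
  rw [inv, coinv, ← Finset.card_union_of_disjoint]
  · congr 1
    ext ij
    simp only [Finset.mem_union, Finset.mem_filter_univ, ← and_or_left, and_iff_left_iff_imp]
    exact fun h => h.1.lt_or_gt.symm
  · exact Finset.disjoint_filter.2 fun ij _ hinv hcoinv => lt_asymm hinv.2 hcoinv.2

theorem inv_add_coinv {T : SimpleGraph (Fin (n + 1))} (hT : T.IsTree) :
    inv T + coinv T = totalDepth T := by
  classical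
  rw [inv_add_coinv_eq_card, Finset.card_filter, Fintype.sum_prod_type_right, totalDepth]
  exact Finset.sum_congr rfl fun j _ => by rw [← Finset.card_filter, card_isDescendant hT]

end LabelledTrees

/-! ### Parking functions -/

section CountLT

variable {ι : Type*} [Fintype ι]

/-- The number of indices at which `f` takes a value less than `k`. -/
def countLT (f : ι → ℕ) (k : ℕ) : ℕ := (Finset.univ.filter fun i => f i < k).card

theorem countLT_mono (f : ι → ℕ) : Monotone (countLT f) := fun _ _ h =>
  Finset.card_le_card (Finset.monotone_filter_right _ fun _ _ h' => lt_of_lt_of_le h' h)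

theorem countLT_le (f : ι → ℕ) (k : ℕ) : countLT f k ≤ Fintype.card ι := Finset.card_le_univ _

theorem countLT_comp_equiv (f : ι → ℕ) (e : Equiv.Perm ι) (k : ℕ) :
    countLT (f ∘ e) k = countLT f k :=
  Finset.card_equiv e (by simp)

theorem countLT_zero (f : ι → ℕ) : countLT f 0 = 0 := by simp [countLT]

theorem countLT_succ (f : ι → ℕ) (k : ℕ) :
    countLT f (k + 1) = countLT f k + (Finset.univ.filter fun i => f i = k).card := by
  classical
  rw [countLT, countLT, ← Finset.card_union_of_disjoint]
  · congr 1
    ext i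
    simp only [Finset.mem_union, Finset.mem_filter_univ]
    omega
  · exact Finset.disjoint_filter.2 fun _ _ hlt heq => hlt.ne heq

theorem card_sub_countLT_succ (f : ι → ℕ) (k : ℕ) :
    Fintype.card ι - countLT f (k + 1) = (Finset.univ.filter fun i => k < f i).card := by
  classical
  rw [countLT, ← Finset.card_compl, Finset.compl_filter]
  simp only [Nat.not_lt, Nat.succ_le_iff]

theorem sum_card_lt (f : ι → ℕ) {K : ℕ} (hf : ∀ i, f i ≤ K) :
    ∑ k ∈ Finset.range K, (Finset.univ.filter fun i => k < f i).card = ∑ i, f i := by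
  simp only [Finset.card_filter]
  rw [Finset.sum_comm]
  refine Finset.sum_congr rfl fun i _ => ?_
  have hrange : ((Finset.range K).filter fun k => k < f i) = Finset.range (f i) := by
    ext k
    rw [Finset.mem_filter, Finset.mem_range, Finset.mem_range]
    exact and_iff_right_of_imp fun hk => hk.trans_le (hf i)
  rw [← Finset.card_filter, hrange, Finset.card_range]

end CountLT

section Bounce

variable {n : ℕ} {a : Fin n → ℕ}

theorem rearrangement_lt_iff (a : Fin n → ℕ) (x : Fin n) (i : ℕ) :
    rearrangement a x < i ↔ x < countLT a i := by
  rw [← countLT_comp_equiv a (Tuple.sort a)]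
  exact (Tuple.lt_card_lt_iff_apply_lt_of_monotone (Tuple.monotone_sort a)).symm

theorem isParkingFunction_iff : IsParkingFunction a ↔ ∀ i < n, i < countLT a (i + 1) := by
  simp only [IsParkingFunction, Fin.forall_iff, ← Nat.lt_succ_iff, rearrangement_lt_iff,
    Nat.succ_eq_add_one]

theorem IsParkingFunction.lt (ha : IsParkingFunction a) (j : Fin n) : a j < n := by
  have hmem := mem_parkingFunctions.2 ha
  simp only [parkingFunctions, Finset.mem_filter, Fintype.mem_piFinset, Finset.mem_range] at hmem
  exact hmem.1 j

/-- The abscissa at which the ball meets the diagonal after `k` bounces; it stays at `n` once it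
is there. -/
def front (a : Fin n → ℕ) : ℕ → ℕ
  | 0 => 0
  | k + 1 => countLT a (front a k + 1)

theorem front_le (a : Fin n → ℕ) : ∀ k, front a k ≤ n
  | 0 => n.zero_le
  | k + 1 => (countLT_le a (front a k + 1)).trans_eq (Fintype.card_fin n)

theorem front_mono (a : Fin n → ℕ) : Monotone (front a) := by
  refine monotone_nat_of_le_succ fun k => ?_
  induction k with
  | zero => exact Nat.zero_le _
  | succ k ih => exact countLT_mono a (Nat.add_le_add_right ih 1)

theorem front_lt_succ (ha : IsParkingFunction a) {k : ℕ} (hk : front a k < n) :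
    front a k < front a (k + 1) := isParkingFunction_iff.1 ha _ hk

theorem le_front (ha : IsParkingFunction a) {k : ℕ} (hk : k ≤ n) : k ≤ front a k := by
  induction k with
  | zero => exact Nat.zero_le _
  | succ k ih =>
    rcases (front_le a k).lt_or_eq with h | h
    · exact (ih (Nat.le_of_succ_le hk)).trans_lt (front_lt_succ ha h)
    · exact (hk.trans_eq h.symm).trans (front_mono a (Nat.le_succ k))

theorem front_eq (ha : IsParkingFunction a) {k : ℕ} (hk : n ≤ k) : front a k = n :=
  (front_le a k).antisymm ((le_front ha le_rfl).trans (front_mono a hk))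

theorem stepHeight_le_iff (a : Fin n → ℕ) (x : ℕ) {i : ℕ} (hi : i < n) :
    stepHeight a x ≤ i ↔ x < countLT a (i + 1) := by
  rw [stepHeight]
  split_ifs with h
  · rw [← rearrangement_lt_iff a ⟨x, h⟩, Nat.lt_succ_iff]
  · have := (countLT_le a (i + 1)).trans_eq (Fintype.card_fin n)
    omega

theorem hasVerticalStep_iff (a : Fin n → ℕ) (x : ℕ) {i : ℕ} (hi : i < n) :
    HasVerticalStep a x i ↔ x = countLT a (i + 1) := by
  have hleft := stepHeight_le_iff a (x - 1) hi
  have hright := stepHeight_le_iff a x hi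
  have := (countLT_le a (i + 1)).trans_eq (Fintype.card_fin n)
  rw [HasVerticalStep, hleft]
  omega

theorem meetsDiagonal_front (ha : IsParkingFunction a) (k : ℕ) : MeetsDiagonal a (front a k) := by
  induction k with
  | zero => exact .start
  | succ k ih =>
    rcases (front_le a k).lt_or_eq with h | h
    · refine .bounce ih h ⟨⟨(front_lt_succ ha h).le, (hasVerticalStep_iff a _ h).2 rfl⟩, ?_⟩
      exact fun x hx => ((hasVerticalStep_iff a _ h).1 hx.2).ge
    · have hstay : front a (k + 1) = front a k :=
        ((front_le a (k + 1)).trans_eq h.symm).antisymm (front_mono a (Nat.le_succ k))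
      rwa [hstay]

theorem meetsDiagonal_iff (ha : IsParkingFunction a) (x : ℕ) :
    MeetsDiagonal a x ↔ ∃ k, front a k = x := by
  refine ⟨fun h => ?_, fun ⟨k, hk⟩ => hk ▸ meetsDiagonal_front ha k⟩
  induction h with
  | start => exact ⟨0, rfl⟩
  | bounce _ hin hx ih =>
    obtain ⟨k, rfl⟩ := ih
    exact ⟨k + 1, ((hasVerticalStep_iff a _ hin).1 hx.1.2).symm⟩

open Classical in
theorem filter_meetsDiagonal (ha : IsParkingFunction a) :
    (Finset.range (n + 1)).filter (MeetsDiagonal a) = (Finset.range (n + 1)).image (front a) := by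
  ext x
  simp only [Finset.mem_filter, Finset.mem_image, Finset.mem_range, Nat.lt_succ_iff,
    meetsDiagonal_iff ha]
  constructor
  · rintro ⟨-, k, rfl⟩
    rcases le_total k n with hk | hk
    · exact ⟨k, hk, rfl⟩
    · exact ⟨n, le_rfl, (front_eq ha le_rfl).trans (front_eq ha hk).symm⟩
  · rintro ⟨k, -, rfl⟩
    exact ⟨front_le a k, k, rfl⟩

theorem bounce_eq_sum (ha : IsParkingFunction a) :
    DepthBounce.bounce a = ∑ k ∈ Finset.range (n + 1), (n - front a k) := by
  classical
  rw [DepthBounce.bounce, filter_meetsDiagonal ha]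
  refine Finset.sum_image_of_pairwise_eq_zero fun k _ l _ hkl heq => ?_
  by_contra hne
  have hk : front a k < n := by omega
  rcases hkl.lt_or_gt with h | h
  · exact ((front_lt_succ ha hk).trans_le (front_mono a h)).ne heq
  · exact ((front_lt_succ ha (heq ▸ hk)).trans_le (front_mono a h)).ne' heq

end Bounce

section Level

variable {n : ℕ} {a : Fin n → ℕ} {d : Fin (n + 1) → ℕ}

theorem countLT_succ_eq_tail (h0 : d 0 = 0) (k : ℕ) :
    countLT d (k + 1) = countLT (Fin.tail d) (k + 1) + 1 := by
  rw [countLT, Fin.card_filter_univ_succ, if_pos (by omega)]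
  rfl

/-- If the vertices `0, 1, …, n` are listed by increasing values of `d`, the entry of `a` at `j` is
the place (counted from `0`) of a vertex whose value is one less than that of `j + 1`. -/
def IsLevel (a : Fin n → ℕ) (d : Fin (n + 1) → ℕ) : Prop :=
  d 0 = 0 ∧ ∀ j : Fin n,
    0 < d j.succ ∧ a j ∈ Finset.Ico (countLT d (d j.succ - 1)) (countLT d (d j.succ))

/-- The level function of a parking function: the vertex `j + 1` has level `k + 1` if `k` is the
least number of bounces after which the ball has abscissa at least `a j`. -/
def level (a : Fin n → ℕ) : Fin (n + 1) → ℕ :=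
  Fin.cons 0 fun j => sInf {k | a j ≤ front a k} + 1

namespace IsLevel

theorem lt_countLT_iff (h : IsLevel a d) (j : Fin n) (k : ℕ) :
    a j < countLT d k ↔ d j.succ ≤ k := by
  have ha := (h.2 j).2
  rw [Finset.mem_Ico] at ha
  refine ⟨fun hlt => ?_, fun hle => ha.2.trans_le (countLT_mono d hle)⟩
  by_contra! hk
  have := countLT_mono d (Nat.le_pred_of_lt hk)
  rw [Nat.pred_eq_sub_one] at this
  omega

theorem countLT_tail_one (h : IsLevel a d) : countLT (Fin.tail d) 1 = 0 :=
  Finset.card_eq_zero.2 (Finset.filter_eq_empty_iff.2 fun j _ => not_lt.2 (h.2 j).1)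

theorem front_eq_countLT (h : IsLevel a d) (k : ℕ) :
    front a k = countLT (Fin.tail d) (k + 1) := by
  induction k with
  | zero => rw [h.countLT_tail_one, front]
  | succ k ih =>
    rw [front, ih, ← countLT_succ_eq_tail h.1, countLT]
    simp only [h.lt_countLT_iff, ← Nat.lt_succ_iff]
    rfl

theorem le_front_iff (h : IsLevel a d) (j : Fin n) (k : ℕ) :
    a j ≤ front a k ↔ d j.succ ≤ k + 1 := by
  rw [← h.lt_countLT_iff, countLT_succ_eq_tail h.1, ← h.front_eq_countLT, Nat.lt_succ_iff]

theorem level_eq (h : IsLevel a d) : level a = d := by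
  funext i
  refine Fin.cases h.1.symm (fun j => ?_) i
  have hset : {k | a j ≤ front a k} = Set.Ici (d j.succ - 1) := by
    ext k
    rw [Set.mem_ofPred_eq, h.le_front_iff, Set.mem_Ici, Nat.sub_le_iff_le_add]
  rw [level, Fin.cons_succ, hset, csInf_Ici, Nat.sub_add_cancel (h.2 j).1]

theorem isParkingFunction (h : IsLevel a d) : IsParkingFunction a := by
  rw [isParkingFunction_iff]
  intro i hi
  have hex : ∃ k, i < front a k := by
    obtain ⟨K, hK⟩ := Finite.exists_le (Fin.tail d)
    refine ⟨K, hi.trans_eq ?_⟩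
    rw [h.front_eq_countLT, countLT, Finset.filter_true_of_mem fun j _ => Nat.lt_succ_of_le (hK j),
      Finset.card_fin]
  have hlt : i < front a (Nat.find hex) := Nat.find_spec hex
  cases hk : Nat.find hex with
  | zero =>
    rw [hk] at hlt
    exact absurd hlt (Nat.not_lt_zero i)
  | succ k =>
    rw [hk] at hlt
    have hle : front a k ≤ i := not_lt.1 (Nat.find_min hex (by omega))
    exact hlt.trans_le (countLT_mono a (Nat.add_le_add_right hle 1))

theorem bounce_eq (h : IsLevel a d) : DepthBounce.bounce a = ∑ i, d i := by
  have hle (j : Fin n) : Fin.tail d j ≤ n + 1 := by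
    refine (h.le_front_iff j n).1 ?_
    rw [front_eq h.isParkingFunction le_rfl]
    exact (h.isParkingFunction.lt j).le
  have hcard (k : ℕ) :
      n - front a k = (Finset.univ.filter fun j => k < Fin.tail d j).card := by
    rw [← card_sub_countLT_succ, Fintype.card_fin, h.front_eq_countLT]
  simp only [bounce_eq_sum h.isParkingFunction, hcard, sum_card_lt _ hle]
  rw [Fin.sum_univ_succ, h.1, zero_add]
  rfl

end IsLevel

theorem level_succ_le_iff (ha : IsParkingFunction a) (j : Fin n) (k : ℕ) :
    level a j.succ ≤ k + 1 ↔ a j ≤ front a k := by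
  have hne : {k | a j ≤ front a k}.Nonempty := ⟨n, by
    rw [Set.mem_ofPred_eq, front_eq ha le_rfl]
    exact (ha.lt j).le⟩
  rw [level, Fin.cons_succ, Nat.add_le_add_iff_right]
  exact ⟨fun hk => (Nat.sInf_mem hne).trans (front_mono a hk), fun hk => Nat.sInf_le hk⟩

theorem countLT_level (ha : IsParkingFunction a) (k : ℕ) :
    countLT (level a) (k + 1) = front a k + 1 := by
  rw [countLT_succ_eq_tail rfl, Nat.add_right_cancel_iff]
  cases k with
  | zero =>
    exact Finset.card_eq_zero.2
      (Finset.filter_eq_empty_iff.2 fun j _ => not_lt.2 (Nat.le_add_left 1 _))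
  | succ k =>
    rw [front, countLT, countLT]
    simp only [Nat.lt_succ_iff, Fin.tail, level_succ_le_iff ha]

theorem isLevel_level (ha : IsParkingFunction a) : IsLevel a (level a) := by
  refine ⟨rfl, fun j => ?_⟩
  obtain ⟨k, hk⟩ : ∃ k, level a j.succ = k + 1 := ⟨_, rfl⟩
  rw [hk, Nat.add_sub_cancel, Finset.mem_Ico, countLT_level ha]
  refine ⟨Nat.succ_pos k, ?_, Nat.lt_succ_of_le ((level_succ_le_iff ha j k).1 hk.le)⟩
  cases k with
  | zero => exact (countLT_zero _).trans_le (Nat.zero_le _)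
  | succ k =>
    rw [countLT_level ha, Nat.succ_le_iff, ← not_le, ← level_succ_le_iff ha]
    omega

end Level

section Fibers

variable {n : ℕ} {d : Fin (n + 1) → ℕ}

theorem filter_depth_eq (h0 : d 0 = 0) (hd : ∀ j : Fin n, 0 < d j.succ) :
    (parentMaps (0 : Fin (n + 1)) {0}ᶜ).filter (fun p => d = depth 0 p) =
      Fintype.piFinset (Fin.cons {0} fun j : Fin n =>
        Finset.univ.filter fun i => d i = d j.succ - 1) := by
  ext p
  simp only [Finset.mem_filter, Fintype.mem_piFinset, mem_parentMaps_compl, Fin.forall_fin_succ,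
    Fin.cons_zero, Fin.cons_succ, Finset.mem_singleton, Finset.mem_univ, true_and]
  constructor
  · rintro ⟨⟨hroot, hp⟩, rfl⟩
    exact ⟨hroot, fun j => by rw [hp.eq_succ (Fin.succ_ne_zero j), Nat.add_sub_cancel]⟩
  · rintro ⟨hroot, hp⟩
    have hdepth : IsDepth 0 {0}ᶜ p d := by
      refine ⟨h0, fun i hi => ⟨by simp, ?_⟩⟩
      obtain ⟨j, rfl⟩ := Fin.exists_succ_eq.2 (by simpa using hi)
      rw [hp j, Nat.sub_add_cancel (hd j)]
    exact ⟨⟨hroot, hdepth.isDepth_depth⟩, funext fun j => (hdepth.depth_eq (by simp)).symm⟩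

theorem filter_level_eq (h0 : d 0 = 0) (hd : ∀ j : Fin n, 0 < d j.succ) :
    (parkingFunctions n).filter (fun a => d = level a) =
      Fintype.piFinset fun j : Fin n =>
        Finset.Ico (countLT d (d j.succ - 1)) (countLT d (d j.succ)) := by
  ext a
  rw [Finset.mem_filter, Fintype.mem_piFinset, mem_parkingFunctions]
  constructor
  · rintro ⟨ha, rfl⟩ j
    exact ((isLevel_level ha).2 j).2
  · intro ha
    have hlevel : IsLevel a d := ⟨h0, fun j => ⟨hd j, ha j⟩⟩
    exact ⟨hlevel.isParkingFunction, hlevel.level_eq.symm⟩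

theorem card_filter_level_eq (d : Fin (n + 1) → ℕ) :
    ((parkingFunctions n).filter fun a => d = level a).card =
      ((parentMaps (0 : Fin (n + 1)) {0}ᶜ).filter fun p => d = depth 0 p).card := by
  by_cases h : d 0 = 0 ∧ ∀ j : Fin n, 0 < d j.succ
  · rw [filter_depth_eq h.1 h.2, filter_level_eq h.1 h.2, Fintype.card_piFinset,
      Fintype.card_piFinset, Fin.prod_univ_succ, Fin.cons_zero, Finset.card_singleton, one_mul]
    refine Finset.prod_congr rfl fun j _ => ?_
    obtain ⟨k, hk⟩ := Nat.exists_eq_succ_of_ne_zero (h.2 j).ne'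
    rw [Fin.cons_succ, hk, Nat.card_Ico, Nat.succ_sub_one, countLT_succ, Nat.add_sub_cancel_left]
  · rw [Finset.filter_false_of_mem, Finset.filter_false_of_mem]
    · rfl
    · rintro p hp rfl
      obtain ⟨-, hp⟩ := mem_parentMaps_compl.1 hp
      exact h ⟨hp.1, fun j => hp.eq_succ (Fin.succ_ne_zero j) ▸ Nat.succ_pos _⟩
    · rintro a ha rfl
      have hlevel := isLevel_level (mem_parkingFunctions.1 ha)
      exact h ⟨hlevel.1, fun j => (hlevel.2 j).1⟩

theorem map_bounce (n : ℕ) :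
    (parkingFunctions n).val.map DepthBounce.bounce =
      (depthProfiles (0 : Fin (n + 1)) {0}ᶜ).map Multiset.sum := by
  have hlevel : (parkingFunctions n).val.map level =
      (parentMaps (0 : Fin (n + 1)) {0}ᶜ).val.map (depth 0) := by
    ext d
    rw [Multiset.count_map, Multiset.count_map]
    exact card_filter_level_eq d
  calc (parkingFunctions n).val.map DepthBounce.bounce
      = ((parkingFunctions n).val.map level).map fun d => ∑ i, d i := by
        rw [Multiset.map_map]
        exact Multiset.map_congr rfl fun a ha =>
          (isLevel_level (mem_parkingFunctions.1 (Finset.mem_def.2 ha))).bounce_eq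
    _ = (depthProfiles (0 : Fin (n + 1)) {0}ᶜ).map Multiset.sum := by
        rw [hlevel, depthProfiles, Multiset.map_map, Multiset.map_map, Finset.insert_compl_self]
        rfl

end Fibers

section Equidistribution

theorem map_totalDifference_eq_map_totalDepth (n : ℕ) :
    (minimalFactorizations n).val.map totalDifference = (labelledTrees n).val.map totalDepth := by
  have himage : (List.finRange n).toFinset.image Fin.succ = {0}ᶜ := by
    ext i
    simp
  rw [map_totalDifference, map_totalDepth, heightProfiles_eq_depthProfiles (Fin.succ_injective n)
    (List.finRange n) (List.nodup_finRange n) 0 (by simp), himage]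

theorem map_bounce_eq_map_totalDepth (n : ℕ) :
    (parkingFunctions n).val.map DepthBounce.bounce = (labelledTrees n).val.map totalDepth := by
  rw [map_bounce, map_totalDepth]

variable {α β γ : Type*} {s : Finset α} {t : Finset β} {f : α → γ} {g : β → γ}

theorem card_filter_eq_of_map_eq [DecidableEq γ] (h : s.val.map f = t.val.map g) (c : γ) :
    (s.filter fun a => f a = c).card = (t.filter fun b => g b = c).card := by
  simpa [Multiset.count_map, eq_comm, Finset.card_def] using congrArg (Multiset.count c) h

theorem sum_eq_of_map_eq {M : Type*} [AddCommMonoid M] (h : s.val.map f = t.val.map g)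
    (F : γ → M) : ∑ a ∈ s, F (f a) = ∑ b ∈ t, F (g b) := by
  simpa using congrArg (fun m => (m.map F).sum) h

end Equidistribution

end DepthBounce

end

theorem theorem2p3 (n : ℕ) :
    (∀ k : ℕ,
      ((labelledTrees n).filter fun T => totalDepth T = k).card =
        ((minimalFactorizations n).filter fun f => totalDifference f = k).card ∧
      ((minimalFactorizations n).filter fun f => totalDifference f = k).card =
        ((parkingFunctions n).filter fun p => DepthBounce.bounce p = k).card) ∧
    D n = ∑ T ∈ labelledTrees n, (X : ℤ[X]) ^ totalDepth T ∧
    D n = ∑ f ∈ minimalFactorizations n, (X : ℤ[X]) ^ totalDifference f ∧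
    D n = ∑ p ∈ parkingFunctions n, (X : ℤ[X]) ^ DepthBounce.bounce p := by
  have hfactorizations := map_totalDifference_eq_map_totalDepth n
  have hparking := map_bounce_eq_map_totalDepth n
  have hD : D n = ∑ T ∈ labelledTrees n, (X : ℤ[X]) ^ totalDepth T :=
    Finset.sum_congr rfl fun T hT => by rw [inv_add_coinv (mem_labelledTrees.1 hT)]
  exact ⟨fun k => ⟨card_filter_eq_of_map_eq hfactorizations.symm k,
      card_filter_eq_of_map_eq (hfactorizations.trans hparking.symm) k⟩,
    hD, hD.trans (sum_eq_of_map_eq hfactorizations.symm fun k => X ^ k),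
    hD.trans (sum_eq_of_map_eq hparking.symm fun k => X ^ k)⟩
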